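/- Graphs are finite, with at least one vertex, without loops, and may have multiple edges. For a graph $G$, $\omega(G)$ is the number of its connected components and $\mathrm{iso}(G)$ the number of its isolated vertices. For real $t>0$, $G$ is called $t$-tough if $\omega(G\setminus S)\le \max\{1,\frac1t|S|\}$ for all $S\subseteq V(G)$, and $t$-iso-tough if $\mathrm{iso}(G\setminus S)\le \frac1t|S|$ for all $S\subseteq V(G)$. A graph is $m$-tree-connected if it has $m$ pairwise edge-disjoint spanning trees. An $\{r,r+1\}$-factor of $G$ is a spanning subgraph of $G$ in which every vertex has degree $r$ or $r+1$. **Theorem.** Let $m$ and $r$ be positive integers and let $G$ be an $(r+1)$-iso-tough graph. 1. Let $\varepsilon>0$ be a real number with $r\ge (2m-1)\left(\frac{2m}{\varepsilon}+1\right)$. If $$\omega(G\setminus S)\le \frac{1}{2m+\varepsilon}|S|+1\qquad\text{for all } S\subseteq V(G),$$ then $G$ has an $m$-tree-connected $\{r,r+1\}$-factor. 2. In particular, if $G$ is $3m$-tough and $r\ge 6m-3$, then $G$ has an $m$-tree-connected $\{r,r+1\}$-factor. -/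

import Mathlib

/-
Multigraphs are Mathlib's `Graph α β` (vertices in `α`, edges in `β`, parallel edges allowed).
-/

namespace Graph

variable {α β : Type*}

/-- The number `ω(G)` of connected components of a multigraph. Parallel edges and loops do not
affect connectivity, so the components are those of the underlying simple graph. -/
noncomputable def numComponents (G : Graph α β) : ℕ :=
  Nat.card G.toSimpleGraph.ConnectedComponent

/-- The number `iso(G)` of isolated vertices of a multigraph. -/
noncomputable def numIsolated (G : Graph α β) : ℕ :=
  {v ∈ G.vertexSet | ∀ e, ¬ G.Inc e v}.ncard

/-- The degree of a vertex: the number of incident edges, loops being counted twice. -/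
noncomputable def degree (G : Graph α β) (v : α) : ℕ :=
  (G.incidenceSet v).ncard + (G.loopSet v).ncard

/-- `G` is `t`-tough: `ω(G ∖ S) ≤ max {1, |S| / t}` for all `S ⊆ V(G)`. -/
def IsTough (G : Graph α β) (t : ℝ) : Prop :=
  ∀ S ⊆ G.vertexSet, ((G.deleteVerts S).numComponents : ℝ) ≤ max 1 (1 / t * (S.ncard : ℝ))

/-- `G` is `t`-iso-tough: `iso(G ∖ S) ≤ |S| / t` for all `S ⊆ V(G)`. -/
def IsIsoTough (G : Graph α β) (t : ℝ) : Prop :=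
  ∀ S ⊆ G.vertexSet, ((G.deleteVerts S).numIsolated : ℝ) ≤ 1 / t * (S.ncard : ℝ)

/-- A multigraph is a tree if it is connected and has no cycle. Loops and pairs of parallel edges
are cycles, so a tree is simple. -/
def IsTree (T : Graph α β) : Prop :=
  T.Simple ∧ T.toSimpleGraph.IsTree

/-- `G` is `m`-tree-connected: it has `m` edge-disjoint spanning trees. -/
def IsTreeConnected (G : Graph α β) (m : ℕ) : Prop :=
  ∃ T : Fin m → Graph α β, (∀ i, T i ≤s G ∧ (T i).IsTree) ∧
    ∀ i j, i ≠ j → Disjoint (T i).edgeSet (T j).edgeSet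

/-- `H` is an `A`-factor of `G`: a spanning subgraph of `G` all of whose vertex degrees lie
in `A`. -/
def IsFactor (H G : Graph α β) (A : Set ℕ) : Prop :=
  H ≤s G ∧ ∀ v ∈ H.vertexSet, H.degree v ∈ A

end Graph

/-! Only the underlying simple graph matters: one edge is chosen per adjacent pair, which changes
neither components nor isolated vertices. Put τ = 2m + ε. The factor is built as `F ∪ N`. Here `F`
has all degrees r, except for at most one vertex (the set `Q`, needed for parity) of degree r + 1.
`N` is a matching of further edges that avoids `Q`, so all degrees of `F ∪ N` are r or r + 1.

`F` comes from `SimpleGraph.exists_nearly_regular_factor`. Tutte's 1-factor theorem, applied to a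
gadget, gives a sufficient condition for f-factors (`SimpleGraph.exists_factor`). Its component term
is controlled by ω(G∖S) with τ > 2, its degree term by iso-toughness.

`N` comes from `SparseEdges.exists_matching_sparse_tight`. Edge sets with at most m(|X| - 1) edges
inside each nonempty X are the independent sets of a matroid, and by Nash-Williams they are exactly
the unions of m forests. So it suffices that `F ∪ N` has full rank m(|V| - 1). Choose `N` of maximum
rank and then of minimum size. Let S be the stable set of vertices that no rank-preserving local
rearrangement of `N` can uncover (`rigidSet`). By maximality, an edge outside S that is not in `N`
already has its ends in one tight part of a basis `B` of `F` and the `N`-edges away from S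
(`linked_of_notMem_rigidSet`). By minimality, the `N`-edges touching S are all independent over `B`.
If the rank were not full, the number of parts would be large compared with the number of edges
between parts. Light parts yield components after deletion of a set little larger than S, or else
consume many vertices of S; `sum_weights_le` bounds both kinds. Nearly every vertex of S is covered
by `N`, and the hypothesis r ≥ (2m - 1)(2m/ε + 1) is exactly the numerical condition under which
these bounds contradict each other. -/

section

open Finset

set_option linter.unusedSectionVars false

/-! ### The count matroid: sparse sets, tight sets and the partition into tight parts. -/

namespace SparseEdges

variable {V : Type*} [DecidableEq V]

/-- A set of edges is `m`-sparse if every nonempty vertex set `X` spans at most `m (|X| - 1)` of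
its edges. -/
def Sparse (m : ℕ) (I : Finset (Sym2 V)) : Prop :=
  ∀ X : Finset V, X.Nonempty → (I ∩ X.sym2).card + m ≤ m * X.card

/-- A vertex set is `m`-tight for an edge set if it spans exactly `m (|X| - 1)` edges. -/
def Tight (m : ℕ) (I : Finset (Sym2 V)) (X : Finset V) : Prop :=
  X.Nonempty ∧ (I ∩ X.sym2).card + m = m * X.card

/-- Two vertices are `m`-linked in `D` if they lie in a common tight set of a sparse subset
of `D`. -/
def Linked (m : ℕ) (D : Finset (Sym2 V)) (x y : V) : Prop :=
  ∃ I ⊆ D, Sparse m I ∧ ∃ X, Tight m I X ∧ x ∈ X ∧ y ∈ X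

/-- Each edge of `J` is in `B` or is spanned by a tight set of `B`. -/
def Spans (m : ℕ) (B J : Finset (Sym2 V)) : Prop :=
  ∀ e ∈ J, e ∈ B ∨ ∃ X, Tight m B X ∧ e ∈ X.sym2

/-- An edge crosses the partition given by the fibres of `f`. -/
def Crossing {ι : Type*} (f : V → ι) (e : Sym2 V) : Prop :=
  ∃ x ∈ e, ∃ y ∈ e, f x ≠ f y

variable {m : ℕ} {I J B D : Finset (Sym2 V)} {X Y : Finset V} {x y z : V} {e : Sym2 V}

lemma Sparse.mono (h : Sparse m J) (hI : I ⊆ J) : Sparse m I := fun X hX =>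
  (Nat.add_le_add_right (card_le_card (inter_subset_inter_right hI)) m).trans (h X hX)

lemma sparse_empty : Sparse m (∅ : Finset (Sym2 V)) := fun X hX => by
  simpa using Nat.le_mul_of_pos_right m hX.card_pos

lemma inter_sym2_mono (h : X ⊆ Y) : I ∩ X.sym2 ⊆ I ∩ Y.sym2 :=
  inter_subset_inter_left (sym2_mono h)

lemma Sparse.tight_singleton (h : Sparse m I) (x : V) : Tight m I {x} := by
  refine ⟨singleton_nonempty x, ?_⟩
  have := h {x} (singleton_nonempty x)
  simp at this ⊢
  exact this

lemma card_inter_sym2_supermodular (I : Finset (Sym2 V)) (X Y : Finset V) :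
    (I ∩ X.sym2).card + (I ∩ Y.sym2).card ≤
      (I ∩ (X ∪ Y).sym2).card + (I ∩ (X ∩ Y).sym2).card := by
  rw [← card_union_add_card_inter]
  refine Nat.add_le_add (card_le_card ?_) (card_le_card ?_)
  · exact union_subset (inter_sym2_mono subset_union_left) (inter_sym2_mono subset_union_right)
  · intro e
    simp only [mem_inter, mem_sym2_iff]
    grind

/-- Uncrossing: the number of spanned edges is supermodular and the bound m(|X| - 1) is modular on
intersecting sets, so equality for X and Y forces equality for union and intersection. -/
lemma Tight.union_inter (hI : Sparse m I) (hX : Tight m I X) (hY : Tight m I Y)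
    (h : (X ∩ Y).Nonempty) : Tight m I (X ∪ Y) ∧ Tight m I (X ∩ Y) := by
  have h1 := hI (X ∪ Y) (hX.1.mono subset_union_left)
  have h2 := hI (X ∩ Y) h
  have h3 := card_inter_sym2_supermodular I X Y
  have h4 := congrArg (m * ·) (card_union_add_card_inter X Y)
  simp only [mul_add] at h4
  have h5 := hX.2
  have h6 := hY.2
  exact ⟨⟨hX.1.mono subset_union_left, by omega⟩, ⟨h, by omega⟩⟩

lemma Tight.union (hI : Sparse m I) (hX : Tight m I X) (hY : Tight m I Y)
    (h : (X ∩ Y).Nonempty) : Tight m I (X ∪ Y) := (hX.union_inter hI hY h).1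

lemma Tight.inter (hI : Sparse m I) (hX : Tight m I X) (hY : Tight m I Y)
    (h : (X ∩ Y).Nonempty) : Tight m I (X ∩ Y) := (hX.union_inter hI hY h).2

lemma Tight.mono (hJ : Sparse m J) (hX : Tight m I X) (h : I ⊆ J) : Tight m J X := by
  refine ⟨hX.1, le_antisymm (hJ X hX.1) ?_⟩
  rw [← hX.2]
  exact Nat.add_le_add_right (card_le_card (inter_subset_inter_right h)) m

lemma exists_tight_of_not_sparse_insert (hB : Sparse m B) (h : ¬ Sparse m (insert e B)) :
    ∃ X, Tight m B X ∧ e ∈ X.sym2 := by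
  simp only [Sparse, not_forall, not_le] at h
  obtain ⟨X, hX, h⟩ := h
  have h1 := hB X hX
  by_cases he : e ∈ X.sym2
  · refine ⟨X, ⟨hX, ?_⟩, he⟩
    rw [insert_inter_of_mem he] at h
    have := card_insert_le e (B ∩ X.sym2)
    omega
  · rw [insert_inter_of_notMem he] at h
    omega

lemma exists_basis_extending (hI : Sparse m I) (hID : I ⊆ D) :
    ∃ B, I ⊆ B ∧ B ⊆ D ∧ Sparse m B ∧ Spans m B D := by
  classical
  obtain ⟨B, hB, hmax⟩ := (D.powerset.filter (fun B => I ⊆ B ∧ Sparse m B)).exists_max_image card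
    ⟨I, by simp [hI, hID]⟩
  simp only [mem_filter, mem_powerset] at hB hmax
  refine ⟨B, hB.2.1, hB.1, hB.2.2, fun e he => ?_⟩
  by_contra! hcon
  have : Sparse m (insert e B) := by
    by_contra hns
    obtain ⟨X, hX, heX⟩ := exists_tight_of_not_sparse_insert hB.2.2 hns
    exact hcon.2 X hX heX
  have := hmax (insert e B) ⟨insert_subset he hB.1, hB.2.1.trans (subset_insert _ _), this⟩
  rw [card_insert_of_notMem hcon.1] at this
  omega

lemma exists_basis (m : ℕ) (D : Finset (Sym2 V)) : ∃ B, B ⊆ D ∧ Sparse m B ∧ Spans m B D := by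
  obtain ⟨B, -, h⟩ := exists_basis_extending sparse_empty (empty_subset D) (m := m)
  exact ⟨B, h⟩

lemma not_crossing_iff {ι : Type*} (f : V → ι) :
    ¬ Crossing f s(x, y) ↔ f x = f y := by
  simp only [Crossing, Sym2.mem_iff]
  grind

lemma sum_card_fibres {ι : Type*} [DecidableEq ι] (f : V → ι) (Y : Finset V) :
    ∑ k ∈ Y.image f, (Y.filter (f · = k)).card = Y.card :=
  (card_eq_sum_card_image f Y).symm

/-- An edge that does not cross lies inside exactly one fibre. -/
lemma card_inter_sym2_eq_sum_add_crossing {ι : Type*} [DecidableEq ι] (f : V → ι)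
    [DecidablePred (Crossing f)] (J : Finset (Sym2 V)) (Y : Finset V) :
    (J ∩ Y.sym2).card = ∑ k ∈ Y.image f, (J ∩ (Y.filter (f · = k)).sym2).card +
      ((J ∩ Y.sym2).filter (Crossing f)).card := by
  rw [← card_filter_add_card_filter_not (s := J ∩ Y.sym2) (Crossing f), add_comm]
  congr 1
  rw [← card_biUnion]
  · congr 1
    ext e
    induction e with | h a b =>
    simp only [mem_filter, mem_inter, mk_mem_sym2_iff, not_crossing_iff, mem_biUnion, mem_image]
    constructor
    · rintro ⟨⟨h, ha, hb⟩, hab⟩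
      exact ⟨f b, ⟨b, hb, rfl⟩, h, ⟨ha, hab⟩, hb, rfl⟩
    · rintro ⟨k, -, h, ⟨ha, rfl⟩, hb, hab⟩
      exact ⟨⟨h, ha, hb⟩, hab.symm⟩
  · intro k _ l _ hkl
    refine disjoint_left.2 fun e he he' => hkl ?_
    induction e with | h a b =>
    simp only [mem_filter, mem_inter, mk_mem_sym2_iff] at he he'
    rw [← he.2.1.2, he'.2.1.2]

lemma linked_refl (m : ℕ) (D : Finset (Sym2 V)) (x : V) : Linked m D x x :=
  ⟨∅, empty_subset _, sparse_empty, {x}, sparse_empty.tight_singleton x, by simp⟩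

lemma Linked.symm (h : Linked m D x y) : Linked m D y x := by
  obtain ⟨I, hID, hI, X, hX, hx, hy⟩ := h
  exact ⟨I, hID, hI, X, hX, hy, hx⟩

variable [Fintype V]

open Classical in
/-- The vertices lying with `x` in a common tight set. -/
noncomputable def part (m : ℕ) (I : Finset (Sym2 V)) (x : V) : Finset V :=
  univ.filter fun y => ∃ X, Tight m I X ∧ x ∈ X ∧ y ∈ X

lemma mem_part : y ∈ part m I x ↔ ∃ X, Tight m I X ∧ x ∈ X ∧ y ∈ X := by
  simp [part]

lemma Sparse.mem_part_self (hI : Sparse m I) (x : V) : x ∈ part m I x :=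
  mem_part.2 ⟨{x}, hI.tight_singleton x, by simp⟩

/-- Tight sets through `x` are closed under union, so the part is the largest of them. Consequently
the parts partition the vertex set. -/
lemma Sparse.tight_part (hI : Sparse m I) (x : V) : Tight m I (part m I x) := by
  classical
  obtain ⟨Y, hY, hmax⟩ := (univ.filter (fun X => Tight m I X ∧ x ∈ X)).exists_max_image card
    ⟨{x}, by simp [hI.tight_singleton x]⟩
  simp only [mem_filter, mem_univ, true_and] at hY hmax
  suffices part m I x = Y by rw [this]; exact hY.1
  refine Subset.antisymm (fun y hy => ?_) fun y hy => mem_part.2 ⟨Y, hY.1, hY.2, hy⟩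
  obtain ⟨X, hX, hx, hyX⟩ := mem_part.1 hy
  have h1 := hmax (Y ∪ X) ⟨hY.1.union hI hX ⟨x, by simp [hx, hY.2]⟩, by simp [hx]⟩
  have h2 := eq_of_subset_of_card_le subset_union_left h1
  rw [h2]
  exact mem_union_right _ hyX

lemma Tight.subset_part (hX : Tight m I X) (hx : x ∈ X) : X ⊆ part m I x :=
  fun _ hy => mem_part.2 ⟨X, hX, hx, hy⟩

lemma Sparse.part_eq_iff (hI : Sparse m I) : part m I x = part m I y ↔ x ∈ part m I y := by
  refine ⟨fun h => h ▸ hI.mem_part_self x, fun h => ?_⟩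
  have h1 := (hI.tight_part y).subset_part h
  exact Subset.antisymm ((hI.tight_part x).subset_part (h1 (hI.mem_part_self y))) h1

lemma Tight.not_crossing (hI : Sparse m I) (hX : Tight m I X) (he : e ∈ X.sym2) :
    ¬ Crossing (part m I) e := by
  rintro ⟨x, hx, y, hy, h⟩
  rw [mem_sym2_iff] at he
  exact h (hI.part_eq_iff.2 (hX.subset_part (he y hy) (he x hx)))

/-- The number of edges of `J` inside `Y`, bounded through the parts of `B`. -/
lemma Sparse.card_inter_sym2_add_le [DecidablePred (Crossing (part m B))] (hB : Sparse m B)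
    (hJ : Sparse m J) (hs : Spans m B J) (Y : Finset V) :
    (J ∩ Y.sym2).card + m * (Y.image (part m B)).card ≤
      m * Y.card + ((B ∩ Y.sym2).filter (Crossing (part m B))).card := by
  rw [card_inter_sym2_eq_sum_add_crossing (part m B) J Y, ← sum_card_fibres (part m B) Y, mul_sum]
  have h1 : ∑ k ∈ Y.image (part m B), (J ∩ (Y.filter (part m B · = k)).sym2).card +
      m * (Y.image (part m B)).card ≤
      ∑ k ∈ Y.image (part m B), m * (Y.filter (part m B · = k)).card := by
    rw [mul_comm m, ← smul_eq_mul, ← sum_const, ← sum_add_distrib]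
    refine sum_le_sum fun k hk => hJ _ ?_
    obtain ⟨y, hy, rfl⟩ := mem_image.1 hk
    exact ⟨y, by simp [hy]⟩
  have h2 : ((J ∩ Y.sym2).filter (Crossing (part m B))).card ≤
      ((B ∩ Y.sym2).filter (Crossing (part m B))).card := by
    refine card_le_card fun e he => ?_
    simp only [mem_filter, mem_inter] at he ⊢
    refine ⟨⟨(hs e he.1.1).resolve_right ?_, he.1.2⟩, he.2⟩
    rintro ⟨X, hX, heX⟩
    exact hX.not_crossing hB heX he.2
  omega

lemma Sparse.card_parts_add [DecidablePred (Crossing (part m B))] (hB : Sparse m B)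
    (Y : Finset V) (hY : ∀ y ∈ Y, part m B y ⊆ Y) :
    (B ∩ Y.sym2).card + m * (Y.image (part m B)).card =
      m * Y.card + ((B ∩ Y.sym2).filter (Crossing (part m B))).card := by
  rw [card_inter_sym2_eq_sum_add_crossing (part m B) B Y, ← sum_card_fibres (part m B) Y, mul_sum]
  have h1 : ∑ k ∈ Y.image (part m B), (B ∩ (Y.filter (part m B · = k)).sym2).card +
      m * (Y.image (part m B)).card =
      ∑ k ∈ Y.image (part m B), m * (Y.filter (part m B · = k)).card := by
    rw [mul_comm m, ← smul_eq_mul, ← sum_const, ← sum_add_distrib]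
    refine sum_congr rfl fun k hk => ?_
    obtain ⟨y, hy, rfl⟩ := mem_image.1 hk
    have : Y.filter (part m B · = part m B y) = part m B y := by
      ext z
      simp only [mem_filter, hB.part_eq_iff, and_iff_right_iff_imp]
      exact fun hz => hY y hy hz
    rw [this]
    exact (hB.tight_part y).2
  omega

/-- Inside each part `B` attains the maximum that sparsity allows `J`, and every crossing edge of
`J` belongs to `B`. This makes all bases equicardinal. -/
lemma Sparse.card_le_of_spans (hB : Sparse m B) (hJ : Sparse m J) (hs : Spans m B J) :
    J.card ≤ B.card := by
  classical
  have h1 := hB.card_inter_sym2_add_le hJ hs univ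
  have h2 := hB.card_parts_add univ fun _ _ => subset_univ _
  simp only [sym2_univ, inter_univ] at h1 h2
  omega

/-- The union `Z` of the parts meeting `Y` is tight for `B`: tightness of `Y` for `J` needs m(k - 1)
crossing edges between the k parts, and these all lie in `B`. Hence `Z` is a single part. -/
lemma Tight.subset_part_of_spans (hB : Sparse m B) (hJ : Sparse m J) (hs : Spans m B J)
    (hY : Tight m J Y) (hx : x ∈ Y) : Y ⊆ part m B x := by
  classical
  let Z := Y.biUnion (part m B)
  have hYZ : Y ⊆ Z := fun y hy => mem_biUnion.2 ⟨y, hy, hB.mem_part_self y⟩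
  have hZ : ∀ z ∈ Z, part m B z ⊆ Z := fun z hz => by
    obtain ⟨y, hy, hzy⟩ := mem_biUnion.1 hz
    rw [hB.part_eq_iff.2 hzy]
    exact subset_biUnion_of_mem (part m B) hy
  have himg : Z.image (part m B) = Y.image (part m B) := by
    refine Subset.antisymm (fun k hk => ?_) (image_subset_image hYZ)
    obtain ⟨z, hz, rfl⟩ := mem_image.1 hk
    obtain ⟨y, hy, hzy⟩ := mem_biUnion.1 hz
    exact mem_image.2 ⟨y, hy, (hB.part_eq_iff.2 hzy).symm⟩
  have h1 := hB.card_inter_sym2_add_le hJ hs Y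
  have h2 := hB.card_parts_add Z hZ
  have h3 : ((B ∩ Y.sym2).filter (Crossing (part m B))).card ≤
      ((B ∩ Z.sym2).filter (Crossing (part m B))).card :=
    card_le_card (filter_subset_filter _ (inter_sym2_mono hYZ))
  have h4 := hB Z (hY.1.mono hYZ)
  rw [himg] at h2
  have h5 := hY.2
  have hT : Tight m B Z := ⟨hY.1.mono hYZ, by omega⟩
  exact hYZ.trans (hT.subset_part (hYZ hx))

/-- Linkedness can be read off from any single basis, which makes it an equivalence relation. -/
lemma Linked.iff_of_spans (hBD : B ⊆ D) (hB : Sparse m B) (hs : Spans m B D) :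
    Linked m D x y ↔ part m B x = part m B y := by
  constructor
  · rintro ⟨J, hJD, hJ, X, hX, hx, hy⟩
    rw [hB.part_eq_iff]
    exact hX.subset_part_of_spans hB hJ (fun e he => hs e (hJD he)) hy hx
  · intro h
    exact ⟨B, hBD, hB, part m B y, hB.tight_part y, hB.part_eq_iff.1 h, hB.mem_part_self y⟩

lemma Linked.trans (h : Linked m D x y) (h' : Linked m D y z) : Linked m D x z := by
  obtain ⟨B, hBD, hB, hs⟩ := exists_basis m D
  rw [Linked.iff_of_spans hBD hB hs] at *
  exact h.trans h'

end SparseEdges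

end

/-! ### Closure, exchange and rank in the count matroid, and Nash-Williams' forest decomposition. -/

section

open Finset

set_option linter.unusedSectionVars false

namespace SparseEdges

variable {V : Type*} [DecidableEq V] [Fintype V]
  {m : ℕ} {I J B D D' : Finset (Sym2 V)} {X Y : Finset V} {x y z : V} {e f : Sym2 V}

lemma exists_mem_sym2 (e : Sym2 V) : ∃ x, x ∈ e := by
  induction e with | h a b => exact ⟨a, Sym2.mem_mk_left a b⟩

lemma Sparse.not_isDiag (hI : Sparse m I) (he : e ∈ I) : ¬ e.IsDiag := fun hd => by
  induction e with | h a b =>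
  obtain rfl : a = b := hd
  have h1 := (hI.tight_singleton a).2
  have h2 : (I ∩ ({a} : Finset V).sym2).Nonempty :=
    ⟨s(a, a), mem_inter.2 ⟨he, mk_mem_sym2_iff.2 ⟨by simp, by simp⟩⟩⟩
  have h3 := h2.card_pos
  simp only [card_singleton, mul_one] at h1
  omega

/-! ### Linkedness and rank -/

/-- The ends of each edge of `D` outside `D'` are linked in `D'`. -/
def Covers (m : ℕ) (D' D : Finset (Sym2 V)) : Prop :=
  ∀ e ∈ D, e ∈ D' ∨ ∀ x ∈ e, ∀ y ∈ e, Linked m D' x y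

lemma Covers.spans (h : Covers m D' D) (hBD : B ⊆ D') (hB : Sparse m B) (hs : Spans m B D') :
    Spans m B D := fun e he => by
  obtain h | h := h e he
  · exact hs e h
  · right
    induction e with | h a b =>
    have := h a (Sym2.mem_mk_left a b) b (Sym2.mem_mk_right a b)
    rw [Linked.iff_of_spans hBD hB hs, hB.part_eq_iff] at this
    exact ⟨part m B b, hB.tight_part b, mk_mem_sym2_iff.2 ⟨this, hB.mem_part_self b⟩⟩

/-- Idempotence of the matroid closure: a basis of `D'` also spans `D`. -/
lemma Linked.of_covers (h : Covers m D' D) (hxy : Linked m D x y) : Linked m D' x y := by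
  obtain ⟨B, hBD, hB, hs⟩ := exists_basis m D'
  obtain ⟨J, hJD, hJ, X, hX, hx, hy⟩ := hxy
  rw [Linked.iff_of_spans hBD hB hs, hB.part_eq_iff]
  exact hX.subset_part_of_spans hB hJ (fun e he => h.spans hBD hB hs e (hJD he)) hy hx

lemma Linked.mono (h : D ⊆ D') (hxy : Linked m D x y) : Linked m D' x y :=
  hxy.of_covers fun _ he => Or.inl (h he)

/-- The exchange axiom for the closure. The edge `s(a, b)` must lie in the tight set that links `x`
and `y`, and replacing it there by `s(x, y)` keeps the count. -/
lemma Linked.exchange {a b : V} (hmem : s(x, y) ∉ D) (hxy : ¬ Linked m D x y)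
    (h : Linked m (insert s(a, b) D) x y) : Linked m (insert s(x, y) D) a b := by
  obtain ⟨B, hBD, hB, hs⟩ := exists_basis m D
  have hxy' := hxy
  rw [Linked.iff_of_spans hBD hB hs, hB.part_eq_iff] at hxy'
  have hab : ¬ (s(a, b) ∈ B ∨ ∃ X, Tight m B X ∧ s(a, b) ∈ X.sym2) := fun hcon => by
    refine hxy' ?_
    rw [← hB.part_eq_iff, ← Linked.iff_of_spans (hBD.trans (subset_insert _ _)) hB]
    · exact h
    · intro e he
      obtain rfl | he := mem_insert.1 he
      exacts [hcon, hs e he]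
  push Not at hab
  have hBf : Sparse m (insert s(a, b) B) := by
    by_contra hcon
    obtain ⟨X, hX, he⟩ := exists_tight_of_not_sparse_insert hB hcon
    exact hab.2 X hX he
  have hsf : Spans m (insert s(a, b) B) (insert s(a, b) D) := fun e he => by
    obtain rfl | he := mem_insert.1 he
    · exact Or.inl (mem_insert_self _ _)
    · obtain h | ⟨X, hX, heX⟩ := hs e he
      · exact Or.inl (mem_insert_of_mem h)
      · exact Or.inr ⟨X, hX.mono hBf (subset_insert _ _), heX⟩
  rw [Linked.iff_of_spans (insert_subset_insert _ hBD) hBf hsf, hBf.part_eq_iff] at h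
  have hX := hBf.tight_part y
  have hy := hBf.mem_part_self y
  set X := part m (insert s(a, b) B) y
  have habX : s(a, b) ∈ X.sym2 := by
    by_contra hcon
    refine hxy ⟨B, hBD, hB, X, ⟨hX.1, ?_⟩, h, hy⟩
    rw [← hX.2, insert_inter_of_notMem hcon]
  have hxyX : s(x, y) ∈ X.sym2 := mk_mem_sym2_iff.2 ⟨h, hy⟩
  have hBe : Sparse m (insert s(x, y) B) := by
    by_contra hcon
    obtain ⟨X, hX, he⟩ := exists_tight_of_not_sparse_insert hB hcon
    rw [mk_mem_sym2_iff] at he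
    exact hxy ⟨B, hBD, hB, X, hX, he.1, he.2⟩
  rw [mk_mem_sym2_iff] at habX
  refine ⟨_, insert_subset_insert _ hBD, hBe, X, ⟨hX.1, ?_⟩, habX.1, habX.2⟩
  rw [← hX.2, insert_inter_of_mem hxyX, insert_inter_of_mem (mk_mem_sym2_iff.2 habX),
    card_insert_of_notMem, card_insert_of_notMem]
  · exact fun h => hab.1 (mem_inter.1 h).1
  · exact fun h => hmem (hBD (mem_inter.1 h).1)

open Classical in
/-- The vertices linked to `x` in `D`. -/
noncomputable def linkClass (m : ℕ) (D : Finset (Sym2 V)) (x : V) : Finset V :=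
  univ.filter (Linked m D x)

lemma mem_linkClass : y ∈ linkClass m D x ↔ Linked m D x y := by simp [linkClass]

/-- A tight set witnessing the link lies within the class, so edges outside the class are
irrelevant. This locality allows rearrangements in different classes to be combined. -/
lemma Linked.restrict (h : Linked m D x y) :
    Linked m (D ∩ (linkClass m D x).sym2) x y := by
  obtain ⟨I, hID, hI, X, hX, hx, hy⟩ := h
  refine ⟨I ∩ X.sym2, inter_subset_inter hID (sym2_mono fun z hz => ?_),
    hI.mono inter_subset_left, X, ⟨hX.1, ?_⟩, hx, hy⟩
  · exact mem_linkClass.2 ⟨I, hID, hI, X, hX, hx, hz⟩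
  · rw [inter_assoc, inter_self, hX.2]

open Classical in
/-- The largest size of an `m`-sparse subset of `D`. -/
noncomputable def rank (m : ℕ) (D : Finset (Sym2 V)) : ℕ :=
  (D.powerset.filter (Sparse m)).sup card

lemma Sparse.card_le_rank (hI : Sparse m I) (h : I ⊆ D) : I.card ≤ rank m D := by
  classical
  exact le_sup (f := card) (by simp [hI, h])

lemma Covers.rank_le (h : Covers m D' D) : rank m D ≤ rank m D' := by
  classical
  obtain ⟨B, hBD, hB, hs⟩ := exists_basis m D'
  refine Finset.sup_le fun J hJ => ?_
  simp only [mem_filter, mem_powerset] at hJ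
  exact (hB.card_le_of_spans hJ.2 fun e he => h.spans hBD hB hs e (hJ.1 he)).trans
    (hB.card_le_rank hBD)

lemma rank_mono (h : D ⊆ D') : rank m D ≤ rank m D' :=
  Covers.rank_le fun _ he => Or.inl (h he)

lemma rank_eq_card (hBD : B ⊆ D) (hB : Sparse m B) (hs : Spans m B D) : rank m D = B.card := by
  classical
  refine le_antisymm (Finset.sup_le fun J hJ => ?_) (hB.card_le_rank hBD)
  simp only [mem_filter, mem_powerset] at hJ
  exact hB.card_le_of_spans hJ.2 fun e he => hs e (hJ.1 he)

lemma rank_insert_of_not_linked (hmem : s(x, y) ∉ D) (h : ¬ Linked m D x y) :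
    rank m D < rank m (insert s(x, y) D) := by
  obtain ⟨B, hBD, hB, hs⟩ := exists_basis m D
  have hBe : Sparse m (insert s(x, y) B) := by
    by_contra hcon
    obtain ⟨X, hX, he⟩ := exists_tight_of_not_sparse_insert hB hcon
    rw [mk_mem_sym2_iff] at he
    exact h ⟨B, hBD, hB, X, hX, he.1, he.2⟩
  have := hBe.card_le_rank (insert_subset_insert _ hBD)
  rw [card_insert_of_notMem fun h => hmem (hBD h)] at this
  rw [rank_eq_card hBD hB hs]
  omega

/-! ### Decomposition of sparse sets into forests -/

/-- For m = 1 a tight set carries a spanning tree. If `X` split into two nonempty pieces without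
edges between them, the forest would have at most |X| - 2 edges on it. -/
lemma Tight.rel_of_forall_edge {F : Finset (Sym2 V)} (hF : Sparse 1 F) (hX : Tight 1 F X)
    {R : V → V → Prop} (hR : Equivalence R) (h : ∀ a b, s(a, b) ∈ F → a ∈ X → b ∈ X → R a b)
    (hx : x ∈ X) (hy : y ∈ X) : R x y := by
  classical
  by_contra hxy
  have h1 := hF (X.filter (R x)) ⟨x, by simp [hx, hR.refl x]⟩
  have h2 := hF (X.filter (¬ R x ·)) ⟨y, by simp [hy, hxy]⟩
  have h3 := card_filter_add_card_filter_not (s := X) (R x)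
  have h4 : F ∩ X.sym2 ⊆ (F ∩ (X.filter (R x)).sym2) ∪ (F ∩ (X.filter (¬ R x ·)).sym2) := by
    intro e
    induction e with | h a b =>
    simp only [mem_inter, mem_union, mk_mem_sym2_iff, mem_filter]
    rintro ⟨hab, ha, hb⟩
    have := h a b hab ha hb
    by_cases hxa : R x a
    · exact Or.inl ⟨hab, ⟨ha, hxa⟩, hb, hR.trans hxa this⟩
    · exact Or.inr ⟨hab, ⟨ha, hxa⟩, hb, fun hxb => hxa (hR.trans hxb (hR.symm this))⟩
  have h5 := (card_le_card h4).trans (card_union_le _ _)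
  have h6 := hX.2
  omega

/-- `X` is the smallest tight set of `F` that spans `e`. -/
def IsMinTight (F : Finset (Sym2 V)) (e : Sym2 V) (X : Finset V) : Prop :=
  Tight 1 F X ∧ e ∈ X.sym2 ∧ ∀ Y, Tight 1 F Y → e ∈ Y.sym2 → X ⊆ Y

lemma inter_nonempty_of_mem_sym2 (hX : e ∈ X.sym2) (hY : e ∈ Y.sym2) :
    (X ∩ Y).Nonempty ∧ e ∈ (X ∩ Y).sym2 := by
  induction e with | h a b =>
  simp only [mk_mem_sym2_iff] at hX hY ⊢
  exact ⟨⟨a, by simp [hX, hY]⟩, by simp [hX, hY]⟩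

/-- The minimal tight set plays the role of the vertex set of the fundamental cycle of `e`. -/
lemma exists_isMinTight {F : Finset (Sym2 V)} (hF : Sparse 1 F) (h : ¬ Sparse 1 (insert e F)) :
    ∃ X, IsMinTight F e X := by
  classical
  obtain ⟨X, hX, he⟩ := exists_tight_of_not_sparse_insert hF h
  obtain ⟨Y, hY, hmin⟩ := (univ.filter (fun X => Tight 1 F X ∧ e ∈ X.sym2)).exists_min_image card
    ⟨X, mem_filter.2 ⟨mem_univ _, hX, he⟩⟩
  simp only [mem_filter, mem_univ, true_and] at hY hmin
  refine ⟨Y, hY.1, hY.2, fun Z hZ heZ => ?_⟩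
  obtain ⟨hne, heYZ⟩ := inter_nonempty_of_mem_sym2 hY.2 heZ
  have := hmin (Y ∩ Z) ⟨hY.1.inter hF hZ hne, heYZ⟩
  exact inter_eq_left.1 (eq_of_subset_of_card_le inter_subset_left this)

lemma IsMinTight.sparse_swap {F : Finset (Sym2 V)} (hF : Sparse 1 F) (hX : IsMinTight F e X)
    (hf : f ∈ F) (hfX : f ∈ X.sym2) (he : e ∉ F) : Sparse 1 ((insert e F).erase f) := by
  intro Y hY
  have h1 := hF Y hY
  have hef : e ≠ f := fun h => he (h ▸ hf)
  rw [erase_inter]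
  by_cases heY : e ∈ Y.sym2
  · rw [insert_inter_of_mem heY]
    by_cases hT : Tight 1 F Y
    · have hfY : f ∈ Y.sym2 := sym2_mono (hX.2.2 Y hT heY) hfX
      rw [card_erase_of_mem (by simp [hf, hfY]), card_insert_of_notMem (by simp [he])]
      omega
    · have h2 := card_le_card (erase_subset f (insert e (F ∩ Y.sym2)))
      have h3 := card_insert_le e (F ∩ Y.sym2)
      have h4 : (F ∩ Y.sym2).card + 1 ≠ 1 * Y.card := fun h => hT ⟨hY, h⟩
      omega
  · rw [insert_inter_of_notMem heY]
    have h2 := card_le_card (erase_subset f (F ∩ Y.sym2))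
    omega

/-- The second alternative arises when `Y` spans `e` but not `f`. Then `Y ∩ X` is not tight by
minimality of `X`, so the deficiency of `Y` in `F` is absorbed by the intersection, and
supermodularity makes the union tight. -/
lemma IsMinTight.tight_of_tight_swap {F : Finset (Sym2 V)} (hF : Sparse 1 F)
    (hX : IsMinTight F e X) (hf : f ∈ F) (hfX : f ∈ X.sym2)
    (hY : Tight 1 ((insert e F).erase f) Y) : Tight 1 F Y ∨ Tight 1 F (Y ∪ X) := by
  have h1 := hY.2
  have h0 := hF Y hY.1
  rw [erase_inter] at h1
  by_cases heY : e ∈ Y.sym2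
  · rw [insert_inter_of_mem heY] at h1
    have h3 := card_insert_le e (F ∩ Y.sym2)
    by_cases hfY : f ∈ Y.sym2
    · rw [card_erase_of_mem (by simp [hf, hfY])] at h1
      exact Or.inl ⟨hY.1, by omega⟩
    · have h2 := card_le_card (erase_subset f (insert e (F ∩ Y.sym2)))
      obtain ⟨hne, hei⟩ := inter_nonempty_of_mem_sym2 heY hX.2.1
      have h4 : ¬ Tight 1 F (Y ∩ X) := fun h =>
        hfY (sym2_mono ((hX.2.2 _ h hei).trans inter_subset_left) hfX)
      have h5 := hF (Y ∩ X) hne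
      have h6 : (F ∩ (Y ∩ X).sym2).card + 1 ≠ 1 * (Y ∩ X).card := fun h => h4 ⟨hne, h⟩
      have h7 := card_inter_sym2_supermodular F Y X
      have h8 := hF (Y ∪ X) (hY.1.mono subset_union_left)
      have h9 := card_union_add_card_inter Y X
      have h10 := hX.1.2
      exact Or.inr ⟨hY.1.mono subset_union_left, by omega⟩
  · rw [insert_inter_of_notMem heY] at h1
    have h2 := card_le_card (erase_subset f (F ∩ Y.sym2))
    exact Or.inl ⟨hY.1, by omega⟩

variable {ι : Type*} [DecidableEq ι] [Fintype ι]

/-- Families of forests together with an uncovered edge obtained from `(F₀, e₀)` by successively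
inserting the uncovered edge into one of the forests and removing another edge of the cycle
that arises. -/
inductive Reach (F₀ : ι → Finset (Sym2 V)) (e₀ : Sym2 V) : (ι → Finset (Sym2 V)) → Sym2 V → Prop
  | refl : Reach F₀ e₀ F₀ e₀
  | step (F : ι → Finset (Sym2 V)) (e : Sym2 V) (i : ι) (X : Finset V) (f : Sym2 V) :
      Reach F₀ e₀ F e → IsMinTight (F i) e X → f ∈ F i → f ∈ X.sym2 →
      Reach F₀ e₀ (Function.update F i ((insert e (F i)).erase f)) f

/-- A decomposition of `I` into `1`-sparse sets. -/
def IsForestDecomp (F : ι → Finset (Sym2 V)) (I : Finset (Sym2 V)) : Prop :=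
  (∀ i, Sparse 1 (F i)) ∧ (∀ i j, i ≠ j → Disjoint (F i) (F j)) ∧ ∀ e, e ∈ I ↔ ∃ i, e ∈ F i

/-- Swaps keep the total edge set `insert e₀ I` and move only the uncovered edge. A reachable state
whose uncovered edge fits into some forest thus decomposes all of `insert e₀ I`. -/
lemma Reach.invariant {F₀ F : ι → Finset (Sym2 V)} {e₀ : Sym2 V} (h : Reach F₀ e₀ F e)
    (hF₀ : IsForestDecomp F₀ I) (he₀ : e₀ ∉ I) :
    ∃ I', IsForestDecomp F I' ∧ e ∉ I' ∧ insert e I' = insert e₀ I := by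
  induction h with
  | refl => exact ⟨I, hF₀, he₀, rfl⟩
  | step F e i X f _ hX hf hfX ih =>
    obtain ⟨I', ⟨hsp, hdis, hI'⟩, he, heq⟩ := ih
    have heF : ∀ j, e ∉ F j := fun j hj => he ((hI' e).2 ⟨j, hj⟩)
    have hef : e ≠ f := fun h => heF i (h ▸ hf)
    have hfI : f ∈ I' := (hI' f).2 ⟨i, hf⟩
    refine ⟨(insert e I').erase f, ⟨fun j => ?_, fun j k hjk => ?_, fun g => ?_⟩, by simp, ?_⟩
    · by_cases hj : j = i
      · subst hj
        simpa using hX.sparse_swap (hsp j) hf hfX (heF j)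
      · simpa [hj] using hsp j
    · have key : ∀ k, k ≠ i → Disjoint ((insert e (F i)).erase f) (F k) := fun k hk =>
        (disjoint_insert_left.2 ⟨heF k, hdis i k hk.symm⟩).mono_left (erase_subset _ _)
      by_cases hj : j = i
      · subst hj
        simpa [hjk.symm] using key k hjk.symm
      · by_cases hk : k = i
        · subst hk
          simpa [hj] using (key j hj).symm
        · simpa [hj, hk] using hdis j k hjk
    · constructor
      · intro hg
        obtain ⟨hgf, hg⟩ := mem_erase.1 hg
        obtain rfl | hg := mem_insert.1 hg
        · exact ⟨i, by simp [hef]⟩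
        · obtain ⟨j, hj⟩ := (hI' g).1 hg
          refine ⟨j, ?_⟩
          by_cases hji : j = i
          · subst hji
            simp [hgf, hj]
          · simpa [hji] using hj
      · rintro ⟨j, hj⟩
        by_cases hji : j = i
        · subst hji
          simp only [Function.update_self, mem_erase, mem_insert] at hj ⊢
          exact ⟨hj.1, hj.2.imp_right fun h => (hI' g).2 ⟨j, h⟩⟩
        · simp only [Function.update_of_ne hji] at hj
          refine mem_erase.2 ⟨?_, mem_insert_of_mem ((hI' g).2 ⟨j, hj⟩)⟩
          rintro rfl
          exact disjoint_left.1 (hdis j i hji) hj hf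
    · rw [insert_erase (mem_insert_of_mem hfI), heq]

lemma IsForestDecomp.insert_of_sparse {F : ι → Finset (Sym2 V)} (hF : IsForestDecomp F I)
    (he : e ∉ I) {i : ι} (h : Sparse 1 (insert e (F i))) :
    IsForestDecomp (Function.update F i (insert e (F i))) (insert e I) := by
  obtain ⟨hsp, hdis, hI⟩ := hF
  have heF : ∀ j, e ∉ F j := fun j hj => he ((hI e).2 ⟨j, hj⟩)
  refine ⟨fun j => ?_, fun j k hjk => ?_, fun g => ?_⟩
  · by_cases hj : j = i
    · subst hj
      simpa using h
    · simpa [hj] using hsp j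
  · have key : ∀ k, k ≠ i → Disjoint (insert e (F i)) (F k) := fun k hk =>
      disjoint_insert_left.2 ⟨heF k, hdis i k hk.symm⟩
    by_cases hj : j = i
    · subst hj
      simpa [hjk.symm, -disjoint_insert_left] using key k hjk.symm
    · by_cases hk : k = i
      · subst hk
        simpa [hj, -disjoint_insert_right] using (key j hj).symm
      · simpa [hj, hk] using hdis j k hjk
  · constructor
    · intro hg
      obtain rfl | hg := mem_insert.1 hg
      · exact ⟨i, by simp⟩
      · obtain ⟨j, hj⟩ := (hI g).1 hg
        refine ⟨j, ?_⟩
        by_cases hji : j = i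
        · subst hji
          simp [hj]
        · simpa [hji] using hj
    · rintro ⟨j, hj⟩
      by_cases hji : j = i
      · subst hji
        simp only [Function.update_self, mem_insert] at hj ⊢
        exact hj.imp_right fun h => (hI g).2 ⟨j, h⟩
      · simp only [Function.update_of_ne hji] at hj
        exact mem_insert_of_mem ((hI g).2 ⟨j, hj⟩)

/-- The induction step of the Nash-Williams theorem. -/
lemma IsForestDecomp.exists_insert {F₀ : ι → Finset (Sym2 V)} {e₀ : Sym2 V}
    (hF₀ : IsForestDecomp F₀ I) (he₀ : e₀ ∉ I) (hI : Sparse (Fintype.card ι) (insert e₀ I)) :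
    ∃ F : ι → Finset (Sym2 V), IsForestDecomp F (insert e₀ I) := by
  classical
  by_contra hcon
  have hmin : ∀ F e, Reach F₀ e₀ F e → ∀ i, ∃ X, IsMinTight (F i) e X := fun F e h i => by
    obtain ⟨I', hF, he, heq⟩ := h.invariant hF₀ he₀
    refine exists_isMinTight (hF.1 i) fun hs => hcon ?_
    rw [← heq]
    exact ⟨_, hF.insert_of_sparse he hs⟩
  have hinv : ∀ F e, Reach F₀ e₀ F e → ∀ i, Sparse 1 (F i) ∧ e ∉ F i := fun F e h i => by
    obtain ⟨I', hF, he, heq⟩ := h.invariant hF₀ he₀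
    exact ⟨hF.1 i, fun hi => he ((hF.2.2 e).2 ⟨i, hi⟩)⟩
  -- `U` collects all fundamental cycles met during swapping. The aim is that every original forest
  -- is a spanning tree on `U`; together with `e₀` this is one edge too many for sparsity on `U`.
  let U : Finset V := univ.filter fun v => ∃ F e i X, Reach F₀ e₀ F e ∧ IsMinTight (F i) e X ∧ v ∈ X
  have hU : ∀ F e i X, Reach F₀ e₀ F e → IsMinTight (F i) e X → X ⊆ U := fun F e i X h hX v hv =>
    mem_filter.2 ⟨mem_univ _, F, e, i, X, h, hX, hv⟩
  -- Connectivity inside `U` is pulled back along the swaps to the original forests.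
  have hpull : ∀ F e, Reach F₀ e₀ F e → ∀ i Y, Tight 1 (F i) Y → Y ⊆ U →
      ∃ Z ⊆ U, Tight 1 (F₀ i) Z ∧ Y ⊆ Z := by
    intro F e h
    induction h with
    | refl => exact fun i Y hY hYU => ⟨Y, hYU, hY, Subset.rfl⟩
    | step F e j X f h hX hf hfX ih =>
      intro i Y hY hYU
      by_cases hij : i = j
      · subst hij
        rw [Function.update_self] at hY
        obtain h' | h' := hX.tight_of_tight_swap (hinv F e h i).1 hf hfX hY
        · exact ih i Y h' hYU
        · obtain ⟨Z, hZ, hZT, hs⟩ := ih i _ h' (union_subset hYU (hU F e i X h hX))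
          exact ⟨Z, hZ, hZT, subset_union_left.trans hs⟩
      · rw [Function.update_of_ne hij] at hY
        exact ih i Y hY hYU
  let R : ι → V → V → Prop := fun i a b => a = b ∨ ∃ Z ⊆ U, Tight 1 (F₀ i) Z ∧ a ∈ Z ∧ b ∈ Z
  have hR : ∀ i, Equivalence (R i) := fun i => by
    refine ⟨fun a => Or.inl rfl, ?_, ?_⟩
    · rintro a b (rfl | ⟨Z, h1, h2, h3, h4⟩)
      exacts [Or.inl rfl, Or.inr ⟨Z, h1, h2, h4, h3⟩]
    · rintro a b c (rfl | ⟨Z, h1, h2, h3, h4⟩) (rfl | ⟨Z', h1', h2', h3', h4'⟩)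
      · exact Or.inl rfl
      · exact Or.inr ⟨Z', h1', h2', h3', h4'⟩
      · exact Or.inr ⟨Z, h1, h2, h3, h4⟩
      · exact Or.inr ⟨Z ∪ Z', union_subset h1 h1',
          h2.union (hF₀.1 i) h2' ⟨b, mem_inter.2 ⟨h4, h3'⟩⟩, mem_union_left _ h3,
          mem_union_right _ h4'⟩
  -- Any edge `s(c, d)` of the cycle can become the uncovered edge; it then closes a cycle in every
  -- forest i, so its ends are related for each i and not only for the forest j.
  have hXR : ∀ F e j X, Reach F₀ e₀ F e → IsMinTight (F j) e X → ∀ i, ∀ a ∈ X, ∀ b ∈ X,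
      R i a b := by
    intro F e j X h hX i a ha b hb
    refine hX.1.rel_of_forall_edge (hinv F e h j).1 (hR i) (fun c d hcd hc hd => ?_) ha hb
    have hs := Reach.step F e j X _ h hX hcd (mk_mem_sym2_iff.2 ⟨hc, hd⟩)
    obtain ⟨X', hX'⟩ := hmin _ _ hs i
    obtain ⟨Z, hZU, hZ, hXZ⟩ := hpull _ _ hs i X' hX'.1 (hU _ _ _ _ hs hX')
    have := mk_mem_sym2_iff.1 hX'.2.1
    exact Or.inr ⟨Z, hZU, hZ, hXZ this.1, hXZ this.2⟩
  obtain ⟨x₀, hx₀⟩ : ∃ x, x ∈ e₀ := exists_mem_sym2 e₀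
  have heR : ∀ i F e, Reach F₀ e₀ F e → ∀ a ∈ e, R i x₀ a := by
    intro i F e h
    induction h with
    | refl =>
      intro a ha
      obtain ⟨X, hX⟩ := hmin _ _ Reach.refl i
      have := mem_sym2_iff.1 hX.2.1
      exact hXR _ _ i X Reach.refl hX i _ (this _ hx₀) _ (this _ ha)
    | step F e j X f h hX hf hfX ih =>
      intro a ha
      obtain ⟨y, hy⟩ : ∃ x, x ∈ e := exists_mem_sym2 e
      exact (hR i).trans (ih y hy) (hXR F e j X h hX i _ (mem_sym2_iff.1 hX.2.1 _ hy) _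
        (mem_sym2_iff.1 hfX _ ha))
  have hUR : ∀ i, ∀ v ∈ U, R i x₀ v := by
    intro i v hv
    obtain ⟨F, e, j, X, h, hX, hvX⟩ := (mem_filter.1 hv).2
    obtain ⟨y, hy⟩ : ∃ x, x ∈ e := exists_mem_sym2 e
    exact (hR i).trans (heR i F e h y hy) (hXR F e j X h hX i _ (mem_sym2_iff.1 hX.2.1 _ hy) _ hvX)
  have hne : Nonempty ι ∨ IsEmpty ι := (isEmpty_or_nonempty ι).symm
  obtain hι | hι := hne
  swap
  · have h1 := hI e₀.toFinset ⟨x₀, by simp [hx₀]⟩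
    simp only [Fintype.card_eq_zero, zero_mul, add_zero, nonpos_iff_eq_zero, card_eq_zero] at h1
    have : e₀ ∈ insert e₀ I ∩ e₀.toFinset.sym2 := by simp [mem_sym2_iff]
    simp [h1] at this
  obtain ⟨i₀⟩ := hι
  obtain ⟨X₀, hX₀⟩ := hmin _ _ Reach.refl i₀
  have hX₀U := hU _ _ _ _ Reach.refl hX₀
  have hx₀U : x₀ ∈ U := hX₀U (mem_sym2_iff.1 hX₀.2.1 _ hx₀)
  have hUT : ∀ i, Tight 1 (F₀ i) U := by
    intro i
    obtain ⟨Y, hY, hmax⟩ := (U.powerset.filter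
      (fun Y => Tight 1 (F₀ i) Y ∧ x₀ ∈ Y)).exists_max_image card
      ⟨{x₀}, by simp [hx₀U, (hF₀.1 i).tight_singleton x₀]⟩
    simp only [mem_filter, mem_powerset] at hY hmax
    obtain ⟨hYU, hYT, hxY⟩ := hY
    suffices U = Y by rw [this]; exact hYT
    refine Subset.antisymm (fun v hv => ?_) hYU
    obtain rfl | ⟨Z, hZU, hZT, hxZ, hvZ⟩ := hUR i v hv
    · exact hxY
    · have h1 := hmax (Y ∪ Z) ⟨union_subset hYU hZU,
        hYT.union (hF₀.1 i) hZT ⟨x₀, mem_inter.2 ⟨hxY, hxZ⟩⟩, mem_union_left _ hxY⟩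
      rw [eq_of_subset_of_card_le subset_union_left h1]
      exact mem_union_right _ hvZ
  have h1 := hI U ⟨x₀, hx₀U⟩
  have h2 : insert e₀ I ∩ U.sym2 = insert e₀ (univ.biUnion fun i => F₀ i ∩ U.sym2) := by
    rw [insert_inter_of_mem (sym2_mono hX₀U hX₀.2.1)]
    congr 1
    ext g
    simp only [mem_inter, mem_biUnion, mem_univ, true_and, hF₀.2.2 g]
    tauto
  rw [h2, card_insert_of_notMem, card_biUnion] at h1
  · have h3 : ∑ i, ((F₀ i ∩ U.sym2).card + 1) = ∑ i : ι, 1 * U.card :=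
      sum_congr rfl fun i _ => (hUT i).2
    rw [sum_add_distrib] at h3
    simp only [sum_const, card_univ, smul_eq_mul, mul_one, one_mul] at h3
    omega
  · exact fun i _ j _ hij => (hF₀.2.1 i j hij).mono inter_subset_left inter_subset_left
  · simp only [mem_biUnion, mem_inter, mem_univ, true_and, not_exists, not_and]
    exact fun i hi => absurd ((hF₀.2.2 e₀).2 ⟨i, hi⟩) he₀

/-- **Nash-Williams' theorem**: an `m`-sparse set is a disjoint union of `m` forests. -/
theorem Sparse.exists_isForestDecomp (hI : Sparse (Fintype.card ι) I) :
    ∃ F : ι → Finset (Sym2 V), IsForestDecomp F I := by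
  induction I using Finset.induction_on with
  | empty => exact ⟨fun _ => ∅, fun _ => sparse_empty, by simp, by simp⟩
  | insert e I he ih =>
    obtain ⟨F, hF⟩ := ih (hI.mono (subset_insert _ _))
    exact hF.exists_insert he hI

/-- A tight sparse set is a disjoint union of spanning trees. -/
theorem Sparse.exists_spanning_trees (hI : Sparse m I) (hT : Tight m I univ) :
    ∃ T : Fin m → SimpleGraph V, (∀ i, (T i).IsTree ∧ ∀ e ∈ (T i).edgeSet, e ∈ I) ∧
      ∀ i j, i ≠ j → Disjoint (T i).edgeSet (T j).edgeSet := by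
  rw [← Fintype.card_fin m] at hI
  obtain ⟨F, hsp, hdis, hF⟩ := hI.exists_isForestDecomp
  have hV : (univ : Finset V).Nonempty := hT.1
  have hle : ∀ i, (F i).card + 1 ≤ Fintype.card V := fun i => by
    simpa using hsp i univ hV
  -- Each forest has at most |V| - 1 edges and the total is m(|V| - 1), so all bounds are attained.
  have hcard : ∀ i, (F i).card + 1 = Fintype.card V := by
    have h1 : I = univ.biUnion F := by ext e; simp [hF]
    have h2 := hT.2
    rw [sym2_univ, inter_univ, h1, card_biUnion fun i _ j _ hij => hdis i j hij] at h2
    have h3 : ∑ i, ((F i).card + 1) = ∑ i : Fin m, Fintype.card V := by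
      rw [sum_add_distrib]
      simpa using h2
    intro i
    exact (sum_eq_sum_iff_of_le fun i _ => hle i).1 h3 i (mem_univ i)
  have hnd : ∀ i, ∀ e ∈ F i, ¬ e.IsDiag := fun i _ he => (hsp i).not_isDiag he
  have hedge : ∀ i, (SimpleGraph.fromEdgeSet (F i : Set (Sym2 V))).edgeSet = F i := fun i => by
    rw [SimpleGraph.edgeSet_fromEdgeSet]
    ext e
    simp only [Set.mem_sdiff, mem_coe]
    exact ⟨fun h => h.1, fun h => ⟨h, hnd i e h⟩⟩
  refine ⟨fun i => SimpleGraph.fromEdgeSet (F i), fun i => ⟨?_, fun e he => ?_⟩, fun i j hij => ?_⟩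
  · rw [SimpleGraph.isTree_iff_connected_and_card]
    refine ⟨?_, ?_⟩
    · have : Nonempty V := ⟨hV.choose⟩
      refine SimpleGraph.Connected.mk fun x y => ?_
      have hTi : Tight 1 (F i) univ := ⟨hV, by simpa using hcard i⟩
      refine hTi.rel_of_forall_edge (hsp i) (SimpleGraph.reachable_is_equivalence _)
        (fun a b hab _ _ => SimpleGraph.Adj.reachable ?_) (mem_univ x) (mem_univ y)
      rw [SimpleGraph.fromEdgeSet_adj]
      exact ⟨hab, fun h => hnd i _ hab h⟩
    · rw [hedge, Nat.card_eq_fintype_card, Nat.card_eq_fintype_card, ← hcard i]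
      simp
  · rw [hedge] at he
    exact (hF e).2 ⟨i, he⟩
  · rw [hedge, hedge, disjoint_coe]
    exact hdis i j hij

end SparseEdges

end

/-! ### Matchings of maximum rank and the vertices that cannot be uncovered. -/

section

open Finset

set_option linter.unusedSectionVars false

namespace SparseEdges

variable {V : Type*} [DecidableEq V] [Fintype V]
  {m : ℕ} {E F N N' : Finset (Sym2 V)} {Q S T : Finset V} {x y v : V} {e f : Sym2 V}

/-- `N` is a matching consisting of edges in `E` that avoid the vertices in `Q`. -/
structure IsMatchingAvoiding (E : Finset (Sym2 V)) (Q : Finset V) (N : Finset (Sym2 V)) :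
    Prop where
  subset : N ⊆ E
  avoid : ∀ v ∈ Q, ∀ e ∈ N, v ∉ e
  eq_of_mem : ∀ e ∈ N, ∀ f ∈ N, ∀ v, v ∈ e → v ∈ f → e = f

lemma IsMatchingAvoiding.mono (h : IsMatchingAvoiding E Q N) (hN : N' ⊆ N) :
    IsMatchingAvoiding E Q N' :=
  ⟨hN.trans h.subset, fun v hv e he => h.avoid v hv e (hN he),
    fun e he f hf => h.eq_of_mem e (hN he) f (hN hf)⟩

open Classical in
/-- The edges of `N` that have no end in `S`. -/
noncomputable def awayFrom (N : Finset (Sym2 V)) (S : Finset V) : Finset (Sym2 V) :=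
  N.filter fun e => ∀ v ∈ e, v ∉ S

lemma mem_awayFrom : e ∈ awayFrom N S ↔ e ∈ N ∧ ∀ v ∈ e, v ∉ S := by simp [awayFrom]

lemma awayFrom_anti (h : S ⊆ T) : awayFrom N T ⊆ awayFrom N S := fun e he => by
  rw [mem_awayFrom] at he ⊢
  exact ⟨he.1, fun v hv hvS => he.2 v hv (h hvS)⟩

lemma awayFrom_subset : awayFrom N S ⊆ N := fun _ he => (mem_awayFrom.1 he).1

/-- `N'` is obtained from the matching `N` by changing edges only inside the class of `v` in
`F ∪ awayFrom N S`, and the vertices of this class remain linked. -/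
structure IsLocalChange (m : ℕ) (E F : Finset (Sym2 V)) (Q : Finset V) (N : Finset (Sym2 V))
    (S : Finset V) (v : V) (N' : Finset (Sym2 V)) : Prop where
  isMatching : IsMatchingAvoiding E Q N'
  mem_iff : ∀ e, e ∉ (linkClass m (F ∪ awayFrom N S) v).sym2 → (e ∈ N' ↔ e ∈ N)
  linked : ∀ a ∈ linkClass m (F ∪ awayFrom N S) v, ∀ b ∈ linkClass m (F ∪ awayFrom N S) v,
    Linked m ((F ∪ N') ∩ (linkClass m (F ∪ awayFrom N S) v).sym2) a b

open Classical in
/-- The successive sets of vertices that cannot be uncovered by local changes. -/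
noncomputable def rigidSet (m : ℕ) (E F : Finset (Sym2 V)) (Q : Finset V)
    (N : Finset (Sym2 V)) : ℕ → Finset V
  | 0 => ∅
  | n + 1 => rigidSet m E F Q N n ∪ univ.filter fun v => v ∈ Q ∨
      ∀ N', IsLocalChange m E F Q N (rigidSet m E F Q N n) v N' → ∃ e ∈ N', v ∈ e

lemma linkClass_eq_of_linked {D : Finset (Sym2 V)} (h : Linked m D x y) :
    linkClass m D x = linkClass m D y := by
  ext z
  rw [mem_linkClass, mem_linkClass]
  exact ⟨h.symm.trans, h.trans⟩

lemma linked_inter_linkClass {D : Finset (Sym2 V)} {a b : V} (ha : a ∈ linkClass m D x)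
    (hb : b ∈ linkClass m D x) : Linked m (D ∩ (linkClass m D x).sym2) a b := by
  rw [mem_linkClass] at ha hb
  have h := (ha.symm.trans hb).restrict
  rwa [← linkClass_eq_of_linked ha] at h

lemma IsMatchingAvoiding.isLocalChange_self (hN : IsMatchingAvoiding E Q N) :
    IsLocalChange m E F Q N S v N :=
  ⟨hN, fun _ _ => Iff.rfl, fun _ ha _ hb => (linked_inter_linkClass ha hb).mono
    (inter_subset_inter_right (union_subset_union_right awayFrom_subset))⟩

lemma rigidSet_mono : Monotone (rigidSet m E F Q N) :=
  monotone_nat_of_le_succ fun n => by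
    rw [rigidSet]
    exact subset_union_left

lemma exists_rigidSet_stable (m : ℕ) (E F : Finset (Sym2 V)) (Q : Finset V)
    (N : Finset (Sym2 V)) : ∃ n, rigidSet m E F Q N (n + 1) = rigidSet m E F Q N n := by
  obtain ⟨n, hn⟩ := WellFoundedGT.monotone_chain_condition
    (⟨rigidSet m E F Q N, rigidSet_mono⟩ : ℕ →o Finset V)
  exact ⟨n, (hn (n + 1) (Nat.le_succ n)).symm⟩

lemma exists_isLocalChange_of_notMem {n : ℕ} (h : v ∉ rigidSet m E F Q N (n + 1)) :
    v ∉ Q ∧ ∃ N', IsLocalChange m E F Q N (rigidSet m E F Q N n) v N' ∧ ∀ e ∈ N', v ∉ e := by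
  simp only [rigidSet, mem_union, mem_filter, mem_univ, true_and, not_or, not_forall,
    not_exists, not_and] at h
  obtain ⟨-, h1, N', h2, h3⟩ := h
  exact ⟨h1, N', h2, h3⟩

/-- The matching is a local change of itself, so it covers every rigid vertex outside `Q`. -/
lemma IsMatchingAvoiding.covered_of_mem_rigidSet (hN : IsMatchingAvoiding E Q N) {n : ℕ}
    (hv : v ∈ rigidSet m E F Q N n) : v ∈ Q ∨ ∃ e ∈ N, v ∈ e := by
  induction n with
  | zero => simp [rigidSet] at hv
  | succ n ih =>
    simp only [rigidSet, mem_union, mem_filter, mem_univ, true_and] at hv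
    obtain h | h | h := hv
    exacts [ih h, Or.inl h, Or.inr (h N hN.isLocalChange_self)]

/-- Adding the elements of a set one by one, there is one that makes `x` and `y` linked. -/
lemma exists_linked_insert {D J : Finset (Sym2 V)} (h : ¬ Linked m D x y)
    (h' : Linked m (D ∪ J) x y) :
    ∃ J₀ ⊆ J, ∃ f ∈ J, f ∉ J₀ ∧ ¬ Linked m (D ∪ J₀) x y ∧ Linked m (insert f (D ∪ J₀)) x y := by
  induction J using Finset.induction_on with
  | empty => exact absurd (by simpa using h') h
  | insert f J hf ih =>
    by_cases hJ : Linked m (D ∪ J) x y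
    · obtain ⟨J₀, h1, f', h2, h3⟩ := ih hJ
      exact ⟨J₀, h1.trans (subset_insert _ _), f', mem_insert_of_mem h2, h3⟩
    · exact ⟨J, subset_insert _ _, f, mem_insert_self _ _, hf, hJ, by rwa [← union_insert]⟩

set_option maxHeartbeats 1600000 in
/-- If the union of `F` and the matching `N` has maximum rank, then outside the set of vertices
that cannot be uncovered all edges have linked ends. -/
lemma IsMatchingAvoiding.linked_of_notMem_rigidSet (hEF : Disjoint E F)
    (hN : IsMatchingAvoiding E Q N)
    (hmax : ∀ N', IsMatchingAvoiding E Q N' → rank m (F ∪ N') ≤ rank m (F ∪ N)) {n : ℕ}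
    (hn : rigidSet m E F Q N (n + 1) = rigidSet m E F Q N n)
    (hx : x ∉ rigidSet m E F Q N n) (hy : y ∉ rigidSet m E F Q N n) (hxyE : s(x, y) ∈ E) :
    s(x, y) ∈ N ∨ Linked m (F ∪ awayFrom N (rigidSet m E F Q N n)) x y := by
  classical
  by_contra! hcon
  obtain ⟨-, hcon⟩ := hcon
  -- Stability puts `x` and `y` outside the next rigid set too, so each can be uncovered within its
  -- own class. The classes are disjoint because `x` and `y` are not linked, so both changes can be
  -- made at once.
  obtain ⟨hxQ, N₁, hN₁, hxN₁⟩ := exists_isLocalChange_of_notMem (hn ▸ hx)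
  obtain ⟨hyQ, N₂, hN₂, hyN₂⟩ := exists_isLocalChange_of_notMem (hn ▸ hy)
  obtain ⟨hm₁, hi₁, hl₁⟩ := hN₁
  obtain ⟨hm₂, hi₂, hl₂⟩ := hN₂
  set R := rigidSet m E F Q N with hRdef
  have hxK₁ : x ∈ linkClass m (F ∪ awayFrom N (R n)) x := mem_linkClass.2 (linked_refl _ _ _)
  have hyK₂ : y ∈ linkClass m (F ∪ awayFrom N (R n)) y := mem_linkClass.2 (linked_refl _ _ _)
  have hK₁ : ∀ a ∈ linkClass m (F ∪ awayFrom N (R n)) x,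
    ∀ b ∈ linkClass m (F ∪ awayFrom N (R n)) x, Linked m (F ∪ awayFrom N (R n)) a b :=
    fun a ha b hb => (mem_linkClass.1 ha).symm.trans (mem_linkClass.1 hb)
  have hK₂ : ∀ a ∈ linkClass m (F ∪ awayFrom N (R n)) y,
    ∀ b ∈ linkClass m (F ∪ awayFrom N (R n)) y, Linked m (F ∪ awayFrom N (R n)) a b :=
    fun a ha b hb => (mem_linkClass.1 ha).symm.trans (mem_linkClass.1 hb)
  have hdis : ∀ a ∈ linkClass m (F ∪ awayFrom N (R n)) x,
      a ∉ linkClass m (F ∪ awayFrom N (R n)) y := fun a ha hb =>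
    hcon ((mem_linkClass.1 ha).trans (mem_linkClass.1 hb).symm)
  set K₁ := linkClass m (F ∪ awayFrom N (R n)) x
  set K₂ := linkClass m (F ∪ awayFrom N (R n)) y
  have hdis2 : ∀ e ∈ K₁.sym2, e ∉ K₂.sym2 := fun e he he' => by
    obtain ⟨a, ha⟩ := exists_mem_sym2 e
    exact hdis a (mem_sym2_iff.1 he a ha) (mem_sym2_iff.1 he' a ha)
  -- `N'` is `N₂` inside `K₂` and `N₁` elsewhere. It misses both `x` and `y`, so `s(x, y)` can be
  -- added to it.
  obtain ⟨N', hN'₁, hN'₂⟩ : ∃ N' : Finset (Sym2 V), (∀ e, e ∉ K₂.sym2 → (e ∈ N' ↔ e ∈ N₁)) ∧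
      ∀ e, e ∉ K₁.sym2 → (e ∈ N' ↔ e ∈ N₂) := by
    refine ⟨N₁.filter (· ∉ K₂.sym2) ∪ N₂.filter (· ∈ K₂.sym2), fun e he => ?_, fun e he => ?_⟩
    · simp only [mem_union, mem_filter]; tauto
    · have h1 := hi₁ e he
      by_cases he2 : e ∈ K₂.sym2
      · simp only [mem_union, mem_filter]; tauto
      · have h2 := hi₂ e he2
        simp only [mem_union, mem_filter]; tauto
  have hN'off : ∀ e, e ∉ K₁.sym2 → e ∉ K₂.sym2 → (e ∈ N' ↔ e ∈ N) := fun e h1 h2 =>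
    (hN'₁ e h2).trans (hi₁ e h1)
  have hmN' : IsMatchingAvoiding E Q N' := by
    have key : ∀ e ∈ N', e ∈ N₁ ∧ e ∉ K₂.sym2 ∨ e ∈ N₂ ∧ e ∉ K₁.sym2 := fun e he => by
      by_cases h : e ∈ K₂.sym2
      · have h1 : e ∉ K₁.sym2 := fun h1 => hdis2 e h1 h
        exact Or.inr ⟨(hN'₂ e h1).1 he, h1⟩
      · exact Or.inl ⟨(hN'₁ e h).1 he, h⟩
    refine ⟨fun e he => ?_, fun v hv e he => ?_, fun e he f hf v hve hvf => ?_⟩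
    · obtain ⟨h, -⟩ | ⟨h, -⟩ := key e he
      exacts [hm₁.subset h, hm₂.subset h]
    · obtain ⟨h, -⟩ | ⟨h, -⟩ := key e he
      exacts [hm₁.avoid v hv e h, hm₂.avoid v hv e h]
    · by_cases h2 : e ∉ K₂.sym2 ∧ f ∉ K₂.sym2
      · exact hm₁.eq_of_mem e ((hN'₁ e h2.1).1 he) f ((hN'₁ f h2.2).1 hf) v hve hvf
      by_cases h1 : e ∉ K₁.sym2 ∧ f ∉ K₁.sym2
      · exact hm₂.eq_of_mem e ((hN'₂ e h1.1).1 he) f ((hN'₂ f h1.2).1 hf) v hve hvf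
      exfalso
      have h3 := hdis2 e
      have h4 := hdis2 f
      have h5 : e ∈ K₁.sym2 ∧ f ∈ K₂.sym2 ∨ f ∈ K₁.sym2 ∧ e ∈ K₂.sym2 := by
        clear * - h1 h2 h3 h4
        tauto
      obtain ⟨h5, h6⟩ | ⟨h5, h6⟩ := h5
      · exact hdis v (mem_sym2_iff.1 h5 v hve) (mem_sym2_iff.1 h6 v hvf)
      · exact hdis v (mem_sym2_iff.1 h5 v hvf) (mem_sym2_iff.1 h6 v hve)
  have hxN' : ∀ e ∈ N', x ∉ e := fun e he hxe =>
    hxN₁ e ((hN'₁ e fun h => hdis x hxK₁ (mem_sym2_iff.1 h x hxe)).1 he) hxe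
  have hyN' : ∀ e ∈ N', y ∉ e := fun e he hye =>
    hyN₂ e ((hN'₂ e fun h => hdis y (mem_sym2_iff.1 h y hye) hyK₂).1 he) hye
  have hxyN' : s(x, y) ∉ N' := fun h => hxN' _ h (Sym2.mem_mk_left x y)
  have hxyF : s(x, y) ∉ F := disjoint_left.1 hEF hxyE
  have hmN'' : IsMatchingAvoiding E Q (insert s(x, y) N') := by
    refine ⟨insert_subset hxyE hmN'.subset, fun v hv e he hve => ?_, fun e he f hf v hve hvf => ?_⟩
    · obtain rfl | he := mem_insert.1 he
      · obtain rfl | rfl := Sym2.mem_iff.1 hve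
        exacts [hxQ hv, hyQ hv]
      · exact hmN'.avoid v hv e he hve
    · obtain rfl | he' := mem_insert.1 he <;> obtain rfl | hf' := mem_insert.1 hf
      · rfl
      · obtain rfl | rfl := Sym2.mem_iff.1 hve
        exacts [absurd hvf (hxN' f hf'), absurd hvf (hyN' f hf')]
      · obtain rfl | rfl := Sym2.mem_iff.1 hvf
        exacts [absurd hve (hxN' e he'), absurd hve (hyN' e he')]
      · exact hmN'.eq_of_mem e he' f hf' v hve hvf
  have hl₁' : ∀ a ∈ K₁, ∀ b ∈ K₁, Linked m ((F ∪ N') ∩ K₁.sym2) a b := fun a ha b hb => by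
    refine (hl₁ a ha b hb).mono fun e he => ?_
    simp only [mem_inter, mem_union] at he ⊢
    have := hN'₁ e (hdis2 e he.2)
    clear * - this he
    tauto
  have hl₂' : ∀ a ∈ K₂, ∀ b ∈ K₂, Linked m ((F ∪ N') ∩ K₂.sym2) a b := fun a ha b hb => by
    refine (hl₂ a ha b hb).mono fun e he => ?_
    simp only [mem_inter, mem_union] at he ⊢
    have := hN'₂ e fun h => hdis2 e h he.2
    clear * - this he
    tauto
  have hnl : ∀ k ≤ n, ¬ Linked m (F ∪ awayFrom N (R k)) x y →
      ¬ Linked m ((F ∪ awayFrom N (R k)).filter (fun e => e ∉ K₁.sym2 ∧ e ∉ K₂.sym2) ∪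
        ((F ∪ N') ∩ K₁.sym2 ∪ (F ∪ N') ∩ K₂.sym2)) x y := by
    intro k hk h h'
    have hsub : F ∪ awayFrom N (R n) ⊆ F ∪ awayFrom N (R k) :=
      union_subset_union_right (awayFrom_anti (rigidSet_mono hk))
    refine h (h'.of_covers fun e he => ?_)
    simp only [mem_union, mem_filter, mem_inter] at he
    by_cases h1 : e ∈ K₁.sym2
    · exact Or.inr fun a ha b hb =>
        (hK₁ a (mem_sym2_iff.1 h1 a ha) b (mem_sym2_iff.1 h1 b hb)).mono hsub
    by_cases h2 : e ∈ K₂.sym2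
    · exact Or.inr fun a ha b hb =>
        (hK₂ a (mem_sym2_iff.1 h2 a ha) b (mem_sym2_iff.1 h2 b hb)).mono hsub
    · left
      simp only [mem_union]
      clear * - he h1 h2
      tauto
  have hcov : Covers m (F ∪ N') (F ∪ N) := fun e he => by
    by_cases h1 : e ∈ K₁.sym2
    · exact Or.inr fun a ha b hb => (hl₁' a (mem_sym2_iff.1 h1 a ha) b
        (mem_sym2_iff.1 h1 b hb)).mono inter_subset_left
    by_cases h2 : e ∈ K₂.sym2
    · exact Or.inr fun a ha b hb => (hl₂' a (mem_sym2_iff.1 h2 a ha) b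
        (mem_sym2_iff.1 h2 b hb)).mono inter_subset_left
    · left
      have := hN'off e h1 h2
      simp only [mem_union] at he ⊢
      clear * - this he
      tauto
  have hR0 : awayFrom N (R 0) = N := by
    ext e
    simp [mem_awayFrom, hRdef, rigidSet]
  -- At level 0 nothing is removed from `N`. Without a link there, `N'` together with `s(x, y)`
  -- would have larger rank than `N`.
  have hlink0 : Linked m (F ∪ awayFrom N (R 0)) x y := by
    by_contra h
    have h' := hnl 0 (Nat.zero_le n) h
    rw [hR0] at h'
    have h'' : ¬ Linked m (F ∪ N') x y := fun hl => h' <| hl.mono fun e he => by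
      simp only [mem_union, mem_filter, mem_inter] at he ⊢
      have := hN'off e
      clear * - this he
      tauto
    have h1 := rank_insert_of_not_linked (by simp [hxyF, hxyN']) h''
    have h2 := hmax _ hmN''
    have h3 := hcov.rank_le
    rw [union_insert] at h2
    omega
  -- The link is lost between levels k and k + 1, hence through removal of `N`-edges touching `R (k
  -- + 1)`. These edges, restored one at a time, yield one edge `f` that restores the link.
  obtain ⟨k, hkn, hk, hk'⟩ : ∃ k < n, Linked m (F ∪ awayFrom N (R k)) x y ∧
      ¬ Linked m (F ∪ awayFrom N (R (k + 1))) x y := by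
    by_contra! h
    have : ∀ k ≤ n, Linked m (F ∪ awayFrom N (R k)) x y := fun k => by
      induction k with
      | zero => exact fun _ => hlink0
      | succ k ih => exact fun hk => h k hk (ih (Nat.le_of_succ_le hk))
    exact hcon (this n le_rfl)
  have hnl' := hnl (k + 1) hkn hk'
  have hsubk : F ∪ awayFrom N (R n) ⊆ F ∪ awayFrom N (R k) :=
    union_subset_union_right (awayFrom_anti (rigidSet_mono hkn.le))
  have hKloc : ∀ a ∈ linkClass m (F ∪ awayFrom N (R k)) x,
      ∀ b ∈ linkClass m (F ∪ awayFrom N (R k)) x,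
      Linked m ((F ∪ awayFrom N (R k)) ∩ (linkClass m (F ∪ awayFrom N (R k)) x).sym2) a b :=
    fun a ha b hb => linked_inter_linkClass ha hb
  have hxK : x ∈ linkClass m (F ∪ awayFrom N (R k)) x := mem_linkClass.2 (linked_refl _ _ _)
  have hyK : y ∈ linkClass m (F ∪ awayFrom N (R k)) x := mem_linkClass.2 hk
  have hK₁K : K₁ ⊆ linkClass m (F ∪ awayFrom N (R k)) x := fun a ha =>
    mem_linkClass.2 ((mem_linkClass.1 ha).mono hsubk)
  have hK₂K : K₂ ⊆ linkClass m (F ∪ awayFrom N (R k)) x := fun a ha =>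
    mem_linkClass.2 (hk.trans ((mem_linkClass.1 ha).mono hsubk))
  have hKeq : ∀ s ∈ linkClass m (F ∪ awayFrom N (R k)) x,
      linkClass m (F ∪ awayFrom N (R k)) s = linkClass m (F ∪ awayFrom N (R k)) x :=
    fun s hs => (linkClass_eq_of_linked (mem_linkClass.1 hs)).symm
  set K := linkClass m (F ∪ awayFrom N (R k)) x
  set D₀ := ((F ∪ awayFrom N (R (k + 1))).filter (fun e => e ∉ K₁.sym2 ∧ e ∉ K₂.sym2) ∪
        ((F ∪ N') ∩ K₁.sym2 ∪ (F ∪ N') ∩ K₂.sym2)) with hD₀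
  have hD₀N' : D₀ ⊆ F ∪ N' := fun e he => by
    simp only [hD₀, mem_union, mem_filter, mem_inter] at he ⊢
    have t1 := hN'off e
    have t2 := @awayFrom_subset V _ _ N (R (k + 1)) e
    clear * - t1 t2 he
    tauto
  obtain ⟨J, hJ⟩ : ∃ J : Finset (Sym2 V), ∀ e, e ∈ J ↔ e ∈ awayFrom N (R k) ∧
      e ∉ awayFrom N (R (k + 1)) ∧ e ∈ K.sym2 ∧ e ∉ K₁.sym2 ∧ e ∉ K₂.sym2 :=
    ⟨(awayFrom N (R k)).filter fun e => e ∉ awayFrom N (R (k + 1)) ∧ e ∈ K.sym2 ∧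
      e ∉ K₁.sym2 ∧ e ∉ K₂.sym2, fun e => by simp⟩
  have hJN' : J ⊆ N' := fun e he => by
    obtain ⟨h1, -, -, h2, h3⟩ := (hJ e).1 he
    exact (hN'off e h2 h3).2 (awayFrom_subset h1)
  have hDJ : Linked m (D₀ ∩ K.sym2 ∪ J) x y := by
    refine (hKloc x hxK y hyK).of_covers fun e he => ?_
    by_cases h1 : e ∈ K₁.sym2
    · refine Or.inr fun a ha b hb => (hl₁' a (mem_sym2_iff.1 h1 a ha) b
        (mem_sym2_iff.1 h1 b hb)).mono fun g hg => ?_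
      have := @sym2_mono _ _ _ hK₁K g
      simp only [hD₀, mem_union, mem_inter] at hg ⊢
      clear * - this hg
      tauto
    by_cases h2 : e ∈ K₂.sym2
    · refine Or.inr fun a ha b hb => (hl₂' a (mem_sym2_iff.1 h2 a ha) b
        (mem_sym2_iff.1 h2 b hb)).mono fun g hg => ?_
      have := @sym2_mono _ _ _ hK₂K g
      simp only [hD₀, mem_union, mem_inter] at hg ⊢
      clear * - this hg
      tauto
    · left
      have := hJ e
      simp only [hD₀, mem_union, mem_inter, mem_filter] at he ⊢
      clear * - this he h1 h2
      tauto
  obtain ⟨J₀, hJ₀, f, hfJ, hfJ₀, hnJ₀, hlJ₀⟩ :=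
    exists_linked_insert (fun h => hnl' (h.mono inter_subset_left)) hDJ
  have hsubJ₀ : D₀ ∩ K.sym2 ∪ J₀ ⊆ F ∪ N' :=
    union_subset (inter_subset_left.trans hD₀N') ((hJ₀.trans hJN').trans subset_union_right)
  have hfl : ∀ a ∈ f, ∀ b ∈ f, Linked m (insert s(x, y) (D₀ ∩ K.sym2 ∪ J₀)) a b := by
    induction f with | h c d =>
    have hcd := Linked.exchange (fun h => by simpa [hxyF, hxyN'] using hsubJ₀ h) hnJ₀ hlJ₀
    intro a ha b hb
    obtain rfl | rfl := Sym2.mem_iff.1 ha <;> obtain rfl | rfl := Sym2.mem_iff.1 hb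
    exacts [linked_refl _ _ _, hcd, hcd.symm, linked_refl _ _ _]
  obtain ⟨hf1, hf2, hf3, hf4, hf5⟩ := (hJ f).1 hfJ
  rw [mem_awayFrom] at hf1 hf2
  push Not at hf2
  obtain ⟨s, hsf, hsR⟩ := hf2 hf1.1
  have hsK : s ∈ K := mem_sym2_iff.1 hf3 s hsf
  have hfN' : f ∈ N' := hJN' hfJ
  have hfF : f ∉ F := disjoint_left.1 hEF (hN.subset hf1.1)
  have hsRn : s ∈ R n := rigidSet_mono (Nat.succ_le_of_lt hkn) hsR
  have hxyK : s(x, y) ∈ K.sym2 := mk_mem_sym2_iff.2 ⟨hxK, hyK⟩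
  -- By exchange the ends of `f` stay linked when `s(x, y)` replaces it, so this is a local change
  -- at level k. It uncovers the end `s` of `f`, contradicting that `s` became rigid at level k + 1.
  have hchange : IsLocalChange m E F Q N (R k) s ((insert s(x, y) N').erase f) := by
    refine ⟨hmN''.mono (erase_subset _ _), fun e he => ?_, fun a ha b hb => ?_⟩
    · rw [hKeq s hsK] at he
      have h1 : e ≠ s(x, y) := fun h => he (h ▸ hxyK)
      have h2 : e ≠ f := fun h => he (h ▸ hf3)
      rw [mem_erase, mem_insert, hN'off e (fun h => he (sym2_mono hK₁K h))
        fun h => he (sym2_mono hK₂K h)]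
      clear * - h1 h2
      tauto
    · rw [hKeq s hsK] at ha hb ⊢
      refine (hKloc a ha b hb).of_covers fun e he => ?_
      by_cases h1 : e ∈ K₁.sym2
      · refine Or.inr fun a ha b hb => (hl₁' a (mem_sym2_iff.1 h1 a ha) b
          (mem_sym2_iff.1 h1 b hb)).mono fun g hg => ?_
        have h2 := @sym2_mono _ _ _ hK₁K g
        have h3 : g ≠ f := fun h => hf4 (h ▸ (mem_inter.1 hg).2)
        simp only [mem_union, mem_inter, mem_erase, mem_insert] at hg ⊢
        clear * - hg h2 h3
        tauto
      by_cases h2 : e ∈ K₂.sym2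
      · refine Or.inr fun a ha b hb => (hl₂' a (mem_sym2_iff.1 h2 a ha) b
          (mem_sym2_iff.1 h2 b hb)).mono fun g hg => ?_
        have h2 := @sym2_mono _ _ _ hK₂K g
        have h3 : g ≠ f := fun h => hf5 (h ▸ (mem_inter.1 hg).2)
        simp only [mem_union, mem_inter, mem_erase, mem_insert] at hg ⊢
        clear * - hg h2 h3
        tauto
      by_cases hef : e = f
      · subst hef
        refine Or.inr fun a ha b hb => (hfl a ha b hb).mono fun g hg => ?_
        obtain rfl | hg := mem_insert.1 hg
        · have : s(x, y) ≠ e := fun h => hxyN' (h ▸ hfN')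
          simp [hxyK, this]
        · have h3 := hsubJ₀ hg
          have h4 : g ≠ e := by
            rintro rfl
            obtain hg | hg := mem_union.1 hg
            · have := (mem_inter.1 hg).1
              have h5 := (hJ g).1 hfJ
              simp only [hD₀, mem_union, mem_filter, mem_inter] at this
              clear * - this h5 hfF
              tauto
            · exact hfJ₀ hg
          have h5 : g ∈ K.sym2 := by
            obtain hg | hg := mem_union.1 hg
            · exact (mem_inter.1 hg).2
            · exact ((hJ g).1 (hJ₀ hg)).2.2.1
          simp only [mem_union, mem_inter, mem_erase, mem_insert] at h3 ⊢
          clear * - h3 h4 h5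
          tauto
      · left
        have h3 := hN'off e h1 h2
        have h4 := @awayFrom_subset V _ _ N (R k) e
        simp only [mem_union, mem_inter, mem_erase, mem_insert] at he ⊢
        clear * - he h1 h2 h3 h4 hef
        tauto
  have hsR' := hsR
  rw [hRdef, rigidSet, ← hRdef] at hsR'
  simp only [mem_union, mem_filter, mem_univ, true_and] at hsR'
  obtain h | h | h := hsR'
  · exact hf1.2 s hsf h
  · exact hN.avoid s h f hf1.1 hsf
  · obtain ⟨e, he, hse⟩ := h _ hchange
    obtain ⟨hef, he⟩ := mem_erase.1 he
    obtain rfl | he := mem_insert.1 he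
    · obtain rfl | rfl := Sym2.mem_iff.1 hse
      exacts [hx hsRn, hy hsRn]
    · exact hef (hmN'.eq_of_mem e he f hfN' s hse hsf)

end SparseEdges

end

/-! ### Counting parts and crossing edges: the matching that gives full rank. -/

section

open Finset

set_option linter.unusedSectionVars false

namespace SparseEdges

variable {V : Type*} [DecidableEq V] [Fintype V]
  {m r : ℕ} {B D E F J N : Finset (Sym2 V)} {K Q S : Finset V} {x y v : V} {e f : Sym2 V}

/-- Every element of `J` is a coloop of `D ∪ J`, so a basis extending `B` contains all of `J`. -/
lemma Sparse.union_of_rank_lt (hBD : B ⊆ D) (hB : Sparse m B)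
    (h : ∀ f ∈ J, rank m ((D ∪ J).erase f) < rank m (D ∪ J)) : Sparse m (B ∪ J) := by
  obtain ⟨B', hBB', hB'D, hB', hs'⟩ := exists_basis_extending hB (hBD.trans subset_union_left)
    (D := D ∪ J)
  refine hB'.mono (union_subset hBB' fun f hf => ?_)
  by_contra hfB'
  have h1 := h f hf
  rw [rank_eq_card hB'D hB' hs'] at h1
  exact absurd (hB'.card_le_rank (subset_erase.2 ⟨hB'D, hfB'⟩)) (not_le.2 h1)

lemma mem_of_crossing (hB : Sparse m B) (hs : Spans m B D) (he : e ∈ D)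
    (hc : Crossing (part m B) e) : e ∈ B :=
  (hs e he).resolve_right fun ⟨_, hX, heX⟩ => hX.not_crossing hB heX hc

open Classical in
/-- The crossing edges of `B` at the vertex `v`. -/
noncomputable def crossAt (m : ℕ) (B : Finset (Sym2 V)) (v : V) : Finset (Sym2 V) :=
  B.filter fun e => Crossing (part m B) e ∧ v ∈ e

open Classical in
/-- The crossing edges of `B` with an end in the part `K`. -/
noncomputable def crossOf (m : ℕ) (B : Finset (Sym2 V)) (K : Finset V) : Finset (Sym2 V) :=
  B.filter fun e => Crossing (part m B) e ∧ ∃ v ∈ e, part m B v = K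

lemma mem_crossAt : e ∈ crossAt m B v ↔ e ∈ B ∧ Crossing (part m B) e ∧ v ∈ e := by
  simp [crossAt]

lemma mem_crossOf :
    e ∈ crossOf m B K ↔ e ∈ B ∧ Crossing (part m B) e ∧ ∃ v ∈ e, part m B v = K := by
  simp [crossOf]

/-- A crossing edge has at most one end in a given part, so no edge is counted twice. -/
lemma sum_card_crossAt_le (hB : Sparse m B) (x : V) :
    ∑ v ∈ part m B x, (crossAt m B v).card ≤ (crossOf m B (part m B x)).card := by
  rw [← card_biUnion]
  · refine card_le_card fun e he => ?_
    obtain ⟨v, hv, he⟩ := mem_biUnion.1 he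
    rw [mem_crossAt] at he
    exact mem_crossOf.2 ⟨he.1, he.2.1, v, he.2.2, hB.part_eq_iff.2 hv⟩
  · intro v hv w hw hvw
    refine disjoint_left.2 fun e he he' => ?_
    rw [mem_crossAt] at he he'
    have h1 : e = s(v, w) := ((Sym2.mem_and_mem_iff hvw).1 ⟨he.2.2, he'.2.2⟩)
    have h2 := he.2.1
    rw [h1] at h2
    exact (not_crossing_iff _).2 ((hB.part_eq_iff.2 hv).trans (hB.part_eq_iff.2 hw).symm) h2

lemma sum_card_crossOf_le [DecidablePred (Crossing (part m B))] :
    ∑ K ∈ univ.image (part m B), (crossOf m B K).card ≤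
      2 * (B.filter (Crossing (part m B))).card := by
  classical
  have h1 : ∀ K ∈ univ.image (part m B), (crossOf m B K).card =
      ((B.filter (Crossing (part m B))).bipartiteAbove
        (fun K e => ∃ v ∈ e, part m B v = K) K).card := fun K _ => by
    congr 1
    ext e
    simp [mem_crossOf, bipartiteAbove, and_assoc]
  rw [sum_congr rfl h1, sum_card_bipartiteAbove_eq_sum_card_bipartiteBelow, mul_comm,
    ← smul_eq_mul, ← sum_const]
  refine sum_le_sum fun e _ => ?_
  induction e with | h a b =>
  refine (card_le_card (t := {part m B a, part m B b}) fun K hK => ?_).trans card_le_two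
  obtain ⟨v, hv, rfl⟩ := (mem_bipartiteBelow _).1 hK |>.2
  obtain rfl | rfl := Sym2.mem_iff.1 hv <;> simp

/-- A small part has many crossing edges. -/
lemma le_card_crossOf_of_card_le (hB : Sparse m B) (hs : Spans m B D) (hFD : F ⊆ D)
    (hF : ∀ e ∈ F, ¬ e.IsDiag) (hdeg : ∀ v, r ≤ (F.filter (v ∈ ·)).card)
    (hK : (part m B x).card ≤ r) : r ≤ (crossOf m B (part m B x)).card := by
  refine le_trans ?_ (sum_card_crossAt_le hB x)
  -- At most |K| - 1 of the `F`-edges at a vertex stay in the part K, since the graph is simple; the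
  -- others cross and so lie in `B`. Summing gives |K|(r - |K| + 1), which is at least r for 1 ≤ |K|
  -- ≤ r.
  have h1 : ∀ v ∈ part m B x, r - ((part m B x).card - 1) ≤ (crossAt m B v).card := by
    intro v hv
    have hsub : F.filter (v ∈ ·) ⊆
        crossAt m B v ∪ ((part m B x).erase v).image (fun w => s(v, w)) := by
      intro e he
      obtain ⟨heF, hve⟩ := mem_filter.1 he
      by_cases hc : Crossing (part m B) e
      · exact mem_union_left _ (mem_crossAt.2 ⟨mem_of_crossing hB hs (hFD heF) hc, hc, hve⟩)
      · obtain ⟨w, rfl⟩ := Sym2.mem_iff_exists.1 hve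
        rw [not_crossing_iff] at hc
        refine mem_union_right _ (mem_image.2 ⟨w, mem_erase.2 ⟨?_, ?_⟩, rfl⟩)
        · rintro rfl
          exact hF _ heF rfl
        · rw [← hB.part_eq_iff, ← hc, hB.part_eq_iff]
          exact hv
    have h2 := (hdeg v).trans ((card_le_card hsub).trans (card_union_le _ _))
    have h3 := (card_image_le (s := (part m B x).erase v) (f := fun w => s(v, w)))
    rw [card_erase_of_mem hv] at h3
    omega
  refine le_trans ?_ (sum_le_sum h1)
  rw [sum_const, smul_eq_mul]
  have hpos : 0 < (part m B x).card := card_pos.2 ⟨x, hB.mem_part_self x⟩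
  obtain ⟨k, hk⟩ : ∃ k, (part m B x).card = k + 1 := ⟨_, (Nat.succ_pred_eq_of_pos hpos).symm⟩
  obtain ⟨l, rfl⟩ : ∃ l, r = k + 1 + l := ⟨r - (k + 1), by omega⟩
  rw [hk, show k + 1 + l - (k + 1 - 1) = l + 1 by omega]
  nlinarith [Nat.zero_le (k * l)]

/-- On the union of the k parts meeting `S`, the set `B` already uses all but m(k - 1) of the edges
that sparsity permits. -/
lemma card_inter_sym2_le_mul_card_parts (hB : Sparse m B) (hBN : Sparse m (B ∪ J))
    (hdis : Disjoint B J) (S : Finset V) :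
    (J ∩ S.sym2).card ≤ m * (S.image (part m B)).card := by
  classical
  obtain rfl | hS := S.eq_empty_or_nonempty
  · simp
  let Z := S.biUnion (part m B)
  have hSZ : S ⊆ Z := fun y hy => mem_biUnion.2 ⟨y, hy, hB.mem_part_self y⟩
  have hZ : ∀ z ∈ Z, part m B z ⊆ Z := fun z hz => by
    obtain ⟨y, hy, hzy⟩ := mem_biUnion.1 hz
    rw [hB.part_eq_iff.2 hzy]
    exact subset_biUnion_of_mem (part m B) hy
  have himg : Z.image (part m B) = S.image (part m B) := by
    refine Subset.antisymm (fun k hk => ?_) (image_subset_image hSZ)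
    obtain ⟨z, hz, rfl⟩ := mem_image.1 hk
    obtain ⟨y, hy, hzy⟩ := mem_biUnion.1 hz
    exact mem_image.2 ⟨y, hy, (hB.part_eq_iff.2 hzy).symm⟩
  have h1 := hB.card_parts_add Z hZ
  have h2 := hBN Z (hS.mono hSZ)
  rw [union_inter_distrib_right, card_union_of_disjoint
    (hdis.mono inter_subset_left inter_subset_left)] at h2
  have h3 := card_le_card (inter_sym2_mono (I := J) hSZ)
  rw [himg] at h1
  omega

/-- Double counting: each vertex of `S \ Q` lies on an `N`-edge touching `S`, and such an edge
serves two vertices of `S` only if it lies inside `S`. -/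
lemma card_sdiff_le_add (hS : ∀ v ∈ S, v ∈ Q ∨ ∃ e ∈ N, v ∈ e) :
    (S \ Q).card ≤ (N \ awayFrom N S).card + (N ∩ S.sym2).card := by
  classical
  have h1 : (S \ Q).card ≤ ∑ v ∈ S \ Q,
      ((N \ awayFrom N S).bipartiteAbove (fun v e => v ∈ e) v).card := by
    rw [card_eq_sum_ones]
    refine sum_le_sum fun v hv => ?_
    obtain ⟨hvS, hvQ⟩ := mem_sdiff.1 hv
    obtain ⟨e, he, hve⟩ := (hS v hvS).resolve_left hvQ
    refine card_pos.2 ⟨e, (mem_bipartiteAbove _).2 ⟨mem_sdiff.2 ⟨he, fun h => ?_⟩, hve⟩⟩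
    exact (mem_awayFrom.1 h).2 v hve hvS
  rw [sum_card_bipartiteAbove_eq_sum_card_bipartiteBelow] at h1
  have h2 : (N ∩ S.sym2).card = ((N \ awayFrom N S).filter (· ∈ S.sym2)).card := by
    congr 1
    ext e
    simp only [mem_inter, mem_filter, mem_sdiff, mem_awayFrom, not_and, not_forall]
    constructor
    · rintro ⟨h, h'⟩
      refine ⟨⟨h, fun _ => ?_⟩, h'⟩
      obtain ⟨v, hv⟩ := exists_mem_sym2 e
      exact ⟨v, hv, not_not.2 (mem_sym2_iff.1 h' v hv)⟩
    · rintro ⟨h, h'⟩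
      exact ⟨h.1, h'⟩
  rw [h2, card_filter, card_eq_sum_ones (N \ _), ← sum_add_distrib]
  refine h1.trans (sum_le_sum fun e _ => ?_)
  induction e with | h a b =>
  have h3 : (S \ Q).bipartiteBelow (fun v e => v ∈ e) s(a, b) ⊆ ({a, b} : Finset V).filter
      (· ∈ S) := fun v hv => by
    have := (mem_bipartiteBelow _).1 hv
    simp only [Sym2.mem_iff, mem_sdiff] at this
    simp [this.2, this.1.1]
  refine (card_le_card h3).trans ?_
  split_ifs with h
  · exact (card_filter_le _ _).trans card_le_two
  · rw [mk_mem_sym2_iff] at h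
    by_cases ha : a ∈ S
    · have hb : b ∉ S := fun hb => h ⟨ha, hb⟩
      refine (card_le_card (t := {a}) fun v hv => ?_).trans (by simp)
      simp only [mem_filter, mem_insert, mem_singleton] at hv ⊢
      obtain ⟨rfl | rfl, hv⟩ := hv
      exacts [rfl, absurd hv hb]
    · refine (card_le_card (t := {b}) fun v hv => ?_).trans (by simp)
      simp only [mem_filter, mem_insert, mem_singleton] at hv ⊢
      obtain ⟨rfl | rfl, hv⟩ := hv
      exacts [absurd hv ha, rfl]

lemma IsMatchingAvoiding.two_mul_card_le (hN : IsMatchingAvoiding E Q N)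
    (hE : ∀ e ∈ E, ¬ e.IsDiag) (S : Finset V) : 2 * (N ∩ S.sym2).card ≤ (S \ Q).card := by
  classical
  have h1 : ((N ∩ S.sym2).biUnion Sym2.toFinset).card = ∑ e ∈ N ∩ S.sym2, e.toFinset.card := by
    refine card_biUnion fun e he f hf hef => disjoint_left.2 fun v hve hvf => hef ?_
    rw [Sym2.mem_toFinset] at hve hvf
    exact hN.eq_of_mem e (mem_inter.1 he).1 f (mem_inter.1 hf).1 v hve hvf
  have h2 : ∑ e ∈ N ∩ S.sym2, e.toFinset.card = ∑ e ∈ N ∩ S.sym2, 2 :=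
    sum_congr rfl fun e he =>
      Sym2.card_toFinset_of_not_isDiag e (hE e (hN.subset (mem_inter.1 he).1))
  rw [mul_comm, ← smul_eq_mul, ← sum_const, ← h2, ← h1]
  refine card_le_card fun v hv => ?_
  obtain ⟨e, he, hve⟩ := mem_biUnion.1 hv
  rw [Sym2.mem_toFinset] at hve
  obtain ⟨heN, heS⟩ := mem_inter.1 he
  exact mem_sdiff.2 ⟨mem_sym2_iff.1 heS v hve, fun hvQ => hN.avoid v hvQ e heN hve⟩

/-- The vertices in `A` are separated by `T`: they are outside `T`, and there is a labelling that
distinguishes them and that is constant along the edges of `E` outside `T` meeting their classes. -/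
structure IsSeparated (E : Finset (Sym2 V)) (T A : Finset V) (p : V → Finset V) : Prop where
  notMem : ∀ a ∈ A, a ∉ T
  injOn : Set.InjOn p A
  eq_of_mem : ∀ a ∈ A, ∀ x y, s(x, y) ∈ E → x ∉ T → y ∉ T → p x = p a → p y = p a

/-- Deleting a vertex set `T` leaves at most `|T| / τ + 1` components. -/
def FewComponents (τ : ℝ) (E : Finset (Sym2 V)) : Prop :=
  ∀ (T A : Finset V) (p : V → Finset V), IsSeparated E T A p → (A.card : ℝ) ≤ T.card / τ + 1

/-- The weights of the parts that have few crossing edges, bounded by the number of components. -/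
lemma sum_weights_le {τ : ℝ} [Nonempty V] (hm : 0 < m) (hr : 2 * m ≤ r) (hτ : 2 * (m : ℝ) < τ)
    (hB : Sparse m B) (hs : Spans m B D) (hFD : F ⊆ D) (hF : ∀ e ∈ F, ¬ e.IsDiag)
    (hdeg : ∀ v, r ≤ (F.filter (v ∈ ·)).card) (hcomp : FewComponents τ (E ∪ F))
    (hE : ∀ x y, s(x, y) ∈ E → x ∉ S → y ∉ S → part m B x ≠ part m B y → s(x, y) ∈ D) :
    ∑ K ∈ univ.image (part m B), ((m : ℝ) - (crossOf m B K).card / 2) ≤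
      m * S.card / τ + m + m / r * (S.card - (S.image (part m B)).card) := by
  classical
  set p := part m B with hp
  set P := univ.image p
  set c : Finset V → ℕ := fun K => (crossOf m B K).card with hc
  have hrpos : (0 : ℝ) < r := by exact_mod_cast (by omega : 0 < r)
  have hr' : 2 * (m : ℝ) ≤ r := by exact_mod_cast hr
  have hm' : (0 : ℝ) < m := by exact_mod_cast hm
  have hτ0 : 0 < τ := by linarith
  -- Only light parts have positive weight. Those in `L₁` keep a vertex after removal of `S` and of
  -- the boundary vertices `bd`, so they give distinct components; those in `L₂` consist of vertices
  -- of `S` and boundary vertices only.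
  let L := P.filter (fun K => c K < 2 * m)
  let bd : Finset V → Finset V := fun K => K.filter fun v => v ∉ S ∧ (crossAt m B v).Nonempty
  let L₁ := L.filter (fun K => ∃ v ∈ K, v ∉ S ∧ v ∉ bd K)
  let L₂ := L.filter (fun K => ¬ ∃ v ∈ K, v ∉ S ∧ v ∉ bd K)
  have hpart : ∀ K ∈ P, ∃ x, K = p x := fun K hK => by
    obtain ⟨x, -, rfl⟩ := mem_image.1 hK
    exact ⟨x, rfl⟩
  have hmemP : ∀ K ∈ P, ∀ v ∈ K, p v = K := fun K hK v hv => by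
    obtain ⟨x, rfl⟩ := hpart K hK
    exact hB.part_eq_iff.2 hv
  have hbd : ∀ K ∈ P, (bd K).card ≤ c K := fun K hK => by
    obtain ⟨x, rfl⟩ := hpart K hK
    refine le_trans ?_ (sum_card_crossAt_le hB x)
    rw [card_eq_sum_ones]
    refine (sum_le_sum fun v hv => ?_).trans (sum_le_sum_of_subset (filter_subset _ _))
    exact card_pos.2 (mem_filter.1 hv).2.2
  have hL₁P : ∀ K ∈ L₁, K ∈ P := fun K hK => (mem_filter.1 (mem_filter.1 hK).1).1
  have hL₂P : ∀ K ∈ L₂, K ∈ P := fun K hK => (mem_filter.1 (mem_filter.1 hK).1).1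
  have hsplit : ∑ K ∈ P, ((m : ℝ) - c K / 2) ≤
      ∑ K ∈ L₁, ((m : ℝ) - c K / 2) + ∑ K ∈ L₂, ((m : ℝ) - c K / 2) := by
    rw [sum_filter_add_sum_filter_not L, ← sum_filter_add_sum_filter_not P (fun K => c K < 2 * m)]
    refine add_le_of_nonpos_right (sum_nonpos fun K hK => ?_)
    have : 2 * m ≤ c K := not_lt.1 (mem_filter.1 hK).2
    have : 2 * (m : ℝ) ≤ c K := by exact_mod_cast this
    linarith
  have h₁ : ∑ K ∈ L₁, ((m : ℝ) - c K / 2) ≤ m * S.card / τ + m := by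
    have hex : ∀ K ∈ L₁, ∃ v ∈ K, v ∉ S ∧ v ∉ bd K := fun K hK => (mem_filter.1 hK).2
    choose! a haK haS habd using hex
    have hpa : ∀ K ∈ L₁, p (a K) = K := fun K hK => hmemP K (hL₁P K hK) _ (haK K hK)
    have hcard := hcomp (S ∪ L₁.biUnion bd) (L₁.image a) p ⟨?_, ?_, ?_⟩
    · rw [card_image_of_injOn fun K hK K' hK' h => by
        rw [← hpa K hK, ← hpa K' hK']; exact congrArg p h] at hcard
      have h1 : ((S ∪ L₁.biUnion bd).card : ℝ) ≤ S.card + ∑ K ∈ L₁, (c K : ℝ) := by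
        exact_mod_cast (card_union_le _ _).trans (Nat.add_le_add_left
          (card_biUnion_le.trans (sum_le_sum fun K hK => hbd K (hL₁P K hK))) _)
      rw [sum_sub_distrib, ← sum_div, sum_const, nsmul_eq_mul]
      set C := ∑ K ∈ L₁, (c K : ℝ)
      have hC : 0 ≤ C := sum_nonneg fun K _ => Nat.cast_nonneg _
      have h2 : (L₁.card : ℝ) ≤ (S.card + C) / τ + 1 :=
        hcard.trans (by gcongr)
      -- Since τ > 2m, the boundary vertices added to the deleted set are paid for by the terms -c/2
      -- of the weights.
      have h3 : (m : ℝ) * C / τ ≤ C / 2 := by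
        rw [div_le_div_iff₀ hτ0 two_pos]
        nlinarith
      calc (L₁.card : ℝ) * m - C / 2 ≤ ((S.card + C) / τ + 1) * m - C / 2 := by gcongr
        _ = m * S.card / τ + m + (m * C / τ - C / 2) := by ring
        _ ≤ _ := by linarith
    · intro v hv
      obtain ⟨K, hK, rfl⟩ := mem_image.1 hv
      simp only [mem_union, mem_biUnion, not_or, not_exists, not_and]
      refine ⟨haS K hK, fun K' hK' h => ?_⟩
      have : p (a K) = K' := hmemP K' (hL₁P K' hK') _ (mem_filter.1 h).1
      rw [hpa K hK] at this
      subst this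
      exact habd K hK h
    · intro v hv w hw h
      obtain ⟨K, hK, rfl⟩ := mem_image.1 (mem_coe.1 hv)
      obtain ⟨K', hK', rfl⟩ := mem_image.1 (mem_coe.1 hw)
      rw [hpa K hK, hpa K' hK'] at h
      rw [h]
    · intro v hv x y hxy hxT hyT hx
      obtain ⟨K, hK, rfl⟩ := mem_image.1 hv
      simp only [mem_union, mem_biUnion, not_or, not_exists, not_and] at hxT hyT
      rw [hpa K hK] at hx ⊢
      by_contra hy
      have hne : p x ≠ p y := fun h => hy (by rw [← h, hx])
      have hD : s(x, y) ∈ D := by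
        obtain h | h := mem_union.1 hxy
        exacts [hE x y h hxT.1 hyT.1 hne, hFD h]
      have hcr : Crossing p s(x, y) := by
        by_contra h
        exact hne ((not_crossing_iff p).1 h)
      refine hxT.2 K hK (mem_filter.2 ⟨?_, hxT.1, s(x, y), mem_crossAt.2
        ⟨mem_of_crossing hB hs hD hcr, hcr, Sym2.mem_mk_left x y⟩⟩)
      rw [← hx]
      exact hB.mem_part_self x
  have h₂ : ∑ K ∈ L₂, ((m : ℝ) - c K / 2) ≤ m / r * (S.card - (S.image p).card) := by
    -- A light part has fewer than 2m ≤ r crossing edges, hence more than r vertices, and at most `c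
    -- K` of them lie outside `S`. As m/r ≤ 1/2, its weight is at most (m/r)(|K ∩ S| - 1).
    have key : ∀ K ∈ L₂, r + 1 ≤ (S.filter (p · = K)).card + c K ∧ c K < 2 * m := by
      intro K hK
      have hKL := mem_filter.1 (mem_filter.1 hK).1
      have hw := (mem_filter.1 hK).2
      push Not at hw
      have hsub : K ⊆ S.filter (p · = K) ∪ bd K := fun v hv => by
        by_cases hvS : v ∈ S
        · exact mem_union_left _ (mem_filter.2 ⟨hvS, hmemP K hKL.1 v hv⟩)
        · exact mem_union_right _ (hw v hv hvS)
      have h1 := (card_le_card hsub).trans (card_union_le _ _)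
      have h2 := hbd K hKL.1
      have h3 : r < K.card := by
        by_contra h
        obtain ⟨x, rfl⟩ := hpart K hKL.1
        have : r ≤ c (p x) := le_card_crossOf_of_card_le hB hs hFD hF hdeg (not_lt.1 h)
        omega
      exact ⟨by omega, hKL.2⟩
    have hsub : L₂ ⊆ S.image p := fun K hK => by
      have := key K hK
      have h0 : 0 < (S.filter (p · = K)).card := by omega
      obtain ⟨v, hv⟩ := card_pos.1 h0
      exact mem_image.2 ⟨v, (mem_filter.1 hv).1, (mem_filter.1 hv).2⟩
    calc ∑ K ∈ L₂, ((m : ℝ) - c K / 2)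
        ≤ ∑ K ∈ L₂, (m : ℝ) / r * ((S.filter (p · = K)).card - 1) := by
          refine sum_le_sum fun K hK => ?_
          have h1 : (r : ℝ) + 1 ≤ (S.filter (p · = K)).card + c K := by exact_mod_cast (key K hK).1
          have h2 : (m : ℝ) / r * (r - c K) ≤ m / r * ((S.filter (p · = K)).card - 1) :=
            mul_le_mul_of_nonneg_left (by linarith) (by positivity)
          have h3 : (m : ℝ) / r * r = m := div_mul_cancel₀ _ hrpos.ne'
          have h4 : (m : ℝ) / r * c K ≤ 1 / 2 * c K := by
            gcongr ?_ * _
            rw [div_le_div_iff₀ hrpos two_pos]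
            linarith
          rw [mul_sub, h3] at h2
          linarith
      _ ≤ ∑ K ∈ S.image p, (m : ℝ) / r * ((S.filter (p · = K)).card - 1) := by
          refine sum_le_sum_of_subset_of_nonneg hsub fun K hK _ => ?_
          obtain ⟨v, hv, rfl⟩ := mem_image.1 hK
          have : 1 ≤ (S.filter (p · = p v)).card := card_pos.2 ⟨v, mem_filter.2 ⟨hv, rfl⟩⟩
          have : (1 : ℝ) ≤ (S.filter (p · = p v)).card := by exact_mod_cast this
          exact mul_nonneg (by positivity) (by linarith)
      _ = m / r * (S.card - (S.image p).card) := by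
          rw [← mul_sum, sum_sub_distrib, sum_const, nsmul_eq_mul, mul_one]
          congr 2
          exact_mod_cast sum_card_fibres p S
  linarith

/-- If the rank of the union of `F` and a matching cannot be increased, it is full. -/
lemma IsMatchingAvoiding.exists_sparse_tight {τ : ℝ} [Nonempty V] (hm : 0 < m) (hr : 2 * m ≤ r)
    (hτ : 2 * (m : ℝ) < τ) (hrτ : (2 * (m : ℝ) - 1) * τ ≤ r * (τ - 2 * m))
    (hEF : Disjoint E F) (hE : ∀ e ∈ E, ¬ e.IsDiag) (hF : ∀ e ∈ F, ¬ e.IsDiag)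
    (hdeg : ∀ v, r ≤ (F.filter (v ∈ ·)).card) (hcomp : FewComponents τ (E ∪ F))
    (hQ : Q.card ≤ 1) (hN : IsMatchingAvoiding E Q N)
    (hmax : ∀ N', IsMatchingAvoiding E Q N' → rank m (F ∪ N') ≤ rank m (F ∪ N))
    (hmin : ∀ f ∈ N, rank m (F ∪ N.erase f) < rank m (F ∪ N)) :
    ∃ I ⊆ F ∪ N, Sparse m I ∧ Tight m I univ := by
  classical
  obtain ⟨n, hn⟩ := exists_rigidSet_stable m E F Q N
  have hcov : ∀ v ∈ rigidSet m E F Q N n, v ∈ Q ∨ ∃ e ∈ N, v ∈ e :=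
    fun v hv => hN.covered_of_mem_rigidSet hv
  have hlink := fun x y => hN.linked_of_notMem_rigidSet (x := x) (y := y) hEF hmax hn
  set S := rigidSet m E F Q N n
  set D := F ∪ awayFrom N S with hD
  obtain ⟨B, hBD, hB, hs⟩ := exists_basis m D
  have hNF : Disjoint N F := hEF.mono_left hN.subset
  have hDN : D ∪ (N \ awayFrom N S) = F ∪ N := by
    rw [hD, union_assoc, union_sdiff_of_subset awayFrom_subset]
  have hdisD : Disjoint D (N \ awayFrom N S) :=
    disjoint_union_left.2 ⟨(hNF.mono_left sdiff_subset).symm, disjoint_sdiff⟩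
  -- Minimality of `N` makes each of its edges touching `S` essential for the rank.
  have hI : Sparse m (B ∪ (N \ awayFrom N S)) := by
    refine hB.union_of_rank_lt hBD fun f hf => ?_
    rw [hDN]
    have hfN := (mem_sdiff.1 hf).1
    refine lt_of_le_of_lt (rank_mono fun e he => ?_) (hmin f hfN)
    simp only [mem_erase, mem_union] at he ⊢
    tauto
  by_contra hcon
  have hVne : (univ : Finset V).Nonempty := univ_nonempty
  have hIcard : (B ∪ (N \ awayFrom N S)).card + m + 1 ≤ m * Fintype.card V := by
    have h1 := hI univ hVne
    rw [sym2_univ, inter_univ, card_univ] at h1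
    by_contra h
    refine hcon ⟨_, ?_, hI, hVne, ?_⟩
    · rw [← hDN]
      exact union_subset_union_left hBD
    · rw [sym2_univ, inter_univ, card_univ]
      omega
  have hdisB := hdisD.mono_left hBD
  rw [card_union_of_disjoint hdisB] at hIcard
  have hparts := hB.card_parts_add univ fun _ _ => subset_univ _
  rw [sym2_univ, inter_univ, card_univ] at hparts
  have hcross := sum_card_crossOf_le (m := m) (B := B)
  have hweights := sum_weights_le (S := S) hm hr hτ hB hs subset_union_left hF hdeg hcomp ?_
  swap
  · intro x y hxy hx hy hne
    obtain h | h := hlink x y hx hy hxy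
    · refine mem_union_right _ (mem_awayFrom.2 ⟨h, fun v hv => ?_⟩)
      obtain rfl | rfl := Sym2.mem_iff.1 hv
      exacts [hx, hy]
    · exact absurd ((Linked.iff_of_spans hBD hB hs).1 h) hne
  have hcount := card_sdiff_le_add hcov
  have htwo := hN.two_mul_card_le hE S
  have hmt : (N ∩ S.sym2).card ≤ m * (S.image (part m B)).card := by
    refine le_trans (card_le_card fun e he => ?_)
      (card_inter_sym2_le_mul_card_parts hB hI hdisB S)
    obtain ⟨h1, h2⟩ := mem_inter.1 he
    refine mem_inter.2 ⟨mem_sdiff.2 ⟨h1, fun h => ?_⟩, h2⟩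
    obtain ⟨v, hv⟩ := exists_mem_sym2 e
    exact (mem_awayFrom.1 h).2 v hv (mem_sym2_iff.1 h2 v hv)
  have hsQ : S.card ≤ (S \ Q).card + 1 := by
    have := le_card_sdiff Q S
    omega
  rw [sum_sub_distrib, sum_const, nsmul_eq_mul, ← sum_div] at hweights
  have hc1 : ∑ K ∈ univ.image (part m B), ((crossOf m B K).card : ℝ) ≤
      2 * (B.filter (Crossing (part m B))).card := by exact_mod_cast hcross
  have hc2 : ((B.filter (Crossing (part m B))).card : ℝ) + (N \ awayFrom N S).card + m + 1 ≤
      m * (univ.image (part m B)).card := by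
    have : (B.filter (Crossing (part m B))).card + (N \ awayFrom N S).card + m + 1 ≤
      m * (univ.image (part m B)).card := by omega
    exact_mod_cast this
  have hc3 : ((S \ Q).card : ℝ) ≤ (N \ awayFrom N S).card + (N ∩ S.sym2).card := by
    exact_mod_cast hcount
  have hc4 : 2 * ((N ∩ S.sym2).card : ℝ) ≤ (S \ Q).card := by exact_mod_cast htwo
  have hc5 : ((N ∩ S.sym2).card : ℝ) ≤ m * (S.image (part m B)).card := by exact_mod_cast hmt
  have hc6 : (S.card : ℝ) ≤ (S \ Q).card + 1 := by exact_mod_cast hsQ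
  set s : ℝ := (S.card : ℝ)
  set s' : ℝ := ((S \ Q).card : ℝ)
  set t : ℝ := ((S.image (part m B)).card : ℝ)
  set a : ℝ := ((N ∩ S.sym2).card : ℝ)
  have hr2 : (2 : ℝ) ≤ r := by exact_mod_cast (by omega : 2 ≤ r)
  have hr0 : (0 : ℝ) < r := by linarith
  have hm0 : (0 : ℝ) < m := by exact_mod_cast hm
  have hτ0 : 0 < τ := by linarith
  have hs0 : 0 ≤ s := Nat.cast_nonneg _
  -- The +1 is the assumed rank deficiency; the terms m on both sides cancel.
  have hmain : s' - a + 1 ≤ m * s / τ + m / r * (s - t) := by linarith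
  -- The two bounds `s' / 2` and `m * t` for `a` are mixed with weight 1/r on the second, so that
  -- the unknown `t` cancels against `hmain`.
  have ha : a ≤ (1 - 1 / r) * (s' / 2) + 1 / r * (m * t) := by
    have h1 : (0 : ℝ) ≤ 1 / r := by positivity
    have h2 : (1 : ℝ) / r ≤ 1 := by rw [div_le_one hr0]; linarith
    calc a = (1 - 1 / r) * a + 1 / r * a := by ring
      _ ≤ _ := add_le_add (mul_le_mul_of_nonneg_left (by linarith) (by linarith))
        (mul_le_mul_of_nonneg_left hc5 h1)
  -- Cleared of denominators, this is precisely `hrτ`. Since s ≤ s' + 1, what remains is 1 ≤ 1/2 +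
  -- 1/(2r), which fails for r ≥ 2.
  have hcoef : (m : ℝ) / τ + m / r ≤ 1 / 2 + 1 / (2 * r) := by
    rw [div_add_div _ _ hτ0.ne' hr0.ne', div_add_div _ _ two_ne_zero (by positivity),
      div_le_div_iff₀ (by positivity) (by positivity)]
    nlinarith
  have h1 : s' * (1 / 2 + 1 / (2 * r)) + 1 ≤ s * (m / τ + m / r) := by
    have e1 : (m : ℝ) / r * (s - t) = s * (m / r) - 1 / r * (m * t) := by ring
    have e2 : m * s / τ = s * (m / τ) := by ring
    have e3 : (1 - 1 / (r : ℝ)) * (s' / 2) = s' * (1 / 2 - 1 / (2 * r)) := by ring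
    rw [e1, e2] at hmain
    rw [e3] at ha
    linarith
  have h2 : s * (m / τ + m / r) ≤ (s' + 1) * (1 / 2 + 1 / (2 * r)) :=
    mul_le_mul hc6 hcoef (by positivity) (by linarith)
  have h3 : 1 / (2 * (r : ℝ)) ≤ 1 / 4 := by
    rw [div_le_div_iff₀ (by positivity) (by norm_num)]
    linarith
  linarith

/-- An edge set `F` of large minimum degree can be extended by a matching of further edges to a
set that contains `m` disjoint spanning trees. -/
theorem exists_matching_sparse_tight {τ : ℝ} [Nonempty V] (hm : 0 < m) (hr : 2 * m ≤ r)
    (hτ : 2 * (m : ℝ) < τ) (hrτ : (2 * (m : ℝ) - 1) * τ ≤ r * (τ - 2 * m))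
    (hEF : Disjoint E F) (hE : ∀ e ∈ E, ¬ e.IsDiag) (hF : ∀ e ∈ F, ¬ e.IsDiag)
    (hdeg : ∀ v, r ≤ (F.filter (v ∈ ·)).card) (hcomp : FewComponents τ (E ∪ F))
    (hQ : Q.card ≤ 1) :
    ∃ N, IsMatchingAvoiding E Q N ∧ ∃ I ⊆ F ∪ N, Sparse m I ∧ Tight m I univ := by
  classical
  obtain ⟨N₀, hN₀, hmax⟩ := (E.powerset.filter (IsMatchingAvoiding E Q)).exists_max_image
    (fun N => rank m (F ∪ N)) ⟨∅, mem_filter.2 ⟨by simp, by simp, by simp, by simp⟩⟩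
  -- Among the matchings of maximum rank, one of least size: removal of any edge then lowers the
  -- rank.
  obtain ⟨N, hN, hmin⟩ := ((E.powerset.filter (IsMatchingAvoiding E Q)).filter
    (fun N => rank m (F ∪ N₀) ≤ rank m (F ∪ N))).exists_min_image card
    ⟨N₀, mem_filter.2 ⟨hN₀, le_rfl⟩⟩
  simp only [mem_filter, mem_powerset, and_imp] at hmax hN hmin
  refine ⟨N, hN.1.2, hN.1.2.exists_sparse_tight hm hr hτ hrτ hEF hE hF hdeg hcomp hQ
    (fun N' hN' => (hmax N' hN'.subset hN').trans hN.2) fun f hf => ?_⟩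
  by_contra! h
  have h1 := hN.1.2.mono (erase_subset f N)
  have h2 := hmin _ h1.subset h1 (hN.2.trans h)
  have h3 := card_erase_lt_of_mem hf
  omega

end SparseEdges

end

/-! ### Minimal violators of Tutte's condition. -/

section

open Finset

set_option linter.unusedSectionVars false

namespace SimpleGraph

variable {W : Type*} {Γ H H' : SimpleGraph W} {U : Set W} {a b : W}

/-- The spanning subgraph of the edges with no end in `U`. -/
def cutAt (Γ : SimpleGraph W) (U : Set W) : SimpleGraph W where
  Adj a b := Γ.Adj a b ∧ a ∉ U ∧ b ∉ U
  symm := ⟨fun _ _ h => ⟨h.1.symm, h.2.2, h.2.1⟩⟩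
  loopless := ⟨fun _ h => h.1.ne rfl⟩

lemma cutAt_adj : (Γ.cutAt U).Adj a b ↔ Γ.Adj a b ∧ a ∉ U ∧ b ∉ U := Iff.rfl

lemma Reachable.mem_of_closed {s : Set W} (h : H.Reachable a b) (ha : a ∈ s)
    (hs : ∀ a b, a ∈ s → H.Adj a b → b ∈ s) : b ∈ s := by
  rw [reachable_iff_reflTransGen] at h
  induction h with
  | refl => exact ha
  | tail _ h ih => exact hs _ _ ih h

lemma supp_connectedComponentMk_eq {s : Set W} (ha : a ∈ s) (hs : ∀ a b, a ∈ s → H.Adj a b → b ∈ s)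
    (hr : ∀ b ∈ s, H.Reachable a b) : (H.connectedComponentMk a).supp = s := by
  ext b
  rw [ConnectedComponent.mem_supp_iff, ConnectedComponent.eq]
  exact ⟨fun h => h.symm.mem_of_closed ha hs, fun h => (hr b h).symm⟩

/-- Components outside `C` meet no new edge and remain components of `H'`. -/
lemma ncard_oddComponents_le_add [Finite W] (h : H ≤ H') (C : Set H.ConnectedComponent)
    (hC : ∀ a b, H'.Adj a b → ¬ H.Adj a b → H.connectedComponentMk a ∈ C) :
    H.oddComponents.ncard ≤ H'.oddComponents.ncard + C.ncard := by
  have hsupp : ∀ a, H.connectedComponentMk a ∉ C →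
      (H'.connectedComponentMk a).supp = (H.connectedComponentMk a).supp := by
    intro a ha
    refine supp_connectedComponentMk_eq rfl (fun b c hb hbc => ?_) fun b hb => ?_
    · rw [ConnectedComponent.mem_supp_iff] at hb ⊢
      rw [← hb]
      by_cases hH : H.Adj b c
      · exact (ConnectedComponent.eq.2 hH.reachable).symm
      · exact absurd (hb ▸ hC b c hbc hH) ha
    · rw [ConnectedComponent.mem_supp_iff, ConnectedComponent.eq] at hb
      exact hb.symm.mono h
  have h1 : (H.oddComponents \ C).ncard ≤ H'.oddComponents.ncard := by
    refine Set.ncard_le_ncard_of_injOn (fun c => c.map (Hom.ofLE h)) (fun c hc => ?_)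
      (fun c hc c' hc' hcc => ?_) (Set.toFinite _)
    · induction c using ConnectedComponent.ind with | h a =>
      change Odd (H'.connectedComponentMk a).supp.ncard
      rw [hsupp a hc.2]
      exact hc.1
    · induction c using ConnectedComponent.ind with | h a =>
      induction c' using ConnectedComponent.ind with | h b =>
      have h2 : H'.connectedComponentMk a = H'.connectedComponentMk b := hcc
      have h3 := hsupp a hc.2
      rw [h2, hsupp b hc'.2] at h3
      exact (ConnectedComponent.supp_injective h3).symm
  have h2 := Set.ncard_le_ncard_sdiff_add_ncard H.oddComponents C (Set.toFinite _)
  omega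

lemma supp_cutAt_of_mem (ha : a ∈ U) : ((Γ.cutAt U).connectedComponentMk a).supp = {a} := by
  refine supp_connectedComponentMk_eq rfl ?_ fun b hb => ?_
  · rintro b c rfl h
    exact absurd ha h.2.1
  · rw [Set.mem_singleton_iff] at hb
    rw [hb]

/-- `cutAt` keeps the vertices of `U` as isolated vertices. They add |U| odd components, whence the
factor 2 in place of Tutte's 1. -/
lemma IsTutteViolator.two_mul_ncard_lt [Finite W] (h : Γ.IsTutteViolator U) :
    2 * U.ncard < (Γ.cutAt U).oddComponents.ncard := by
  let G' := ((⊤ : Γ.Subgraph).deleteVerts U).coe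
  let φ : G' →g Γ.cutAt U := ⟨Subtype.val, fun {a b} hab => by
    have h1 : ((⊤ : Γ.Subgraph).deleteVerts U).Adj a b := hab
    rw [Subgraph.deleteVerts_adj] at h1
    exact ⟨h1.2.2.2.2, h1.2.1, h1.2.2.2.1⟩⟩
  have hmem : ∀ a : ((⊤ : Γ.Subgraph).deleteVerts U).verts, (a : W) ∉ U := fun a => a.2.2
  have hsupp : ∀ a : ((⊤ : Γ.Subgraph).deleteVerts U).verts,
      ((Γ.cutAt U).connectedComponentMk (a : W)).supp =
      Subtype.val '' (G'.connectedComponentMk a).supp := by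
    intro a
    refine supp_connectedComponentMk_eq ⟨a, rfl, rfl⟩ ?_ ?_
    · rintro _ c ⟨b, hb, rfl⟩ hbc
      have hc : c ∈ ((⊤ : Γ.Subgraph).deleteVerts U).verts := by
        rw [Subgraph.deleteVerts_verts]
        exact ⟨Set.mem_univ _, hbc.2.2⟩
      refine ⟨⟨c, hc⟩, ?_, rfl⟩
      rw [ConnectedComponent.mem_supp_iff] at hb ⊢
      rw [← hb]
      refine (ConnectedComponent.eq.2 (Adj.reachable ?_)).symm
      change ((⊤ : Γ.Subgraph).deleteVerts U).Adj b c
      rw [Subgraph.deleteVerts_adj]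
      exact ⟨Set.mem_univ _, hbc.2.1, Set.mem_univ _, hbc.2.2, hbc.1⟩
    · rintro _ ⟨b, hb, rfl⟩
      rw [ConnectedComponent.mem_supp_iff, ConnectedComponent.eq] at hb
      exact (hb.map φ).symm
  have h1 : G'.oddComponents.ncard ≤
      ((Γ.cutAt U).oddComponents \ ((Γ.cutAt U).connectedComponentMk '' U)).ncard := by
    refine Set.ncard_le_ncard_of_injOn (fun c => c.map φ) (fun c hc => ?_)
      (fun c _ c' _ hcc => ?_) (Set.toFinite _)
    · induction c using ConnectedComponent.ind with | h a =>
      refine ⟨?_, ?_⟩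
      · change Odd ((Γ.cutAt U).connectedComponentMk (a : W)).supp.ncard
        rw [hsupp, Set.ncard_image_of_injective _ Subtype.val_injective]
        exact hc
      · rintro ⟨u, hu, h⟩
        have h2 : (Γ.cutAt U).connectedComponentMk u =
          (Γ.cutAt U).connectedComponentMk (a : W) := h
        have h3 : (a : W) ∈ ((Γ.cutAt U).connectedComponentMk u).supp := by
          rw [h2]
          rfl
        rw [supp_cutAt_of_mem hu] at h3
        exact hmem a (h3 ▸ hu)
    · induction c using ConnectedComponent.ind with | h a =>
      induction c' using ConnectedComponent.ind with | h b =>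
      have h2 : (Γ.cutAt U).connectedComponentMk (a : W) =
        (Γ.cutAt U).connectedComponentMk (b : W) := hcc
      have h3 := hsupp a
      rw [h2, hsupp b] at h3
      exact (ConnectedComponent.supp_injective (Subtype.val_injective.image_injective h3)).symm
  have h2 : (Γ.cutAt U).connectedComponentMk '' U ⊆ (Γ.cutAt U).oddComponents := by
    rintro _ ⟨u, hu, rfl⟩
    change Odd ((Γ.cutAt U).connectedComponentMk u).supp.ncard
    rw [supp_cutAt_of_mem hu, Set.ncard_singleton]
    exact odd_one
  have h3 : ((Γ.cutAt U).connectedComponentMk '' U).ncard = U.ncard := by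
    refine Set.InjOn.ncard_image fun u hu v hv huv => ?_
    have h4 := supp_cutAt_of_mem (Γ := Γ) hu
    rw [huv, supp_cutAt_of_mem hv] at h4
    exact (Set.singleton_injective h4).symm
  have h4 := Set.ncard_sdiff_add_ncard_of_subset h2 (Set.toFinite _)
  have h5 : U.ncard < G'.oddComponents.ncard := h
  omega

/-- A graph of even order without perfect matching has a set `U` violating Tutte's condition such
that the neighbours of each vertex of `U` lie in at least three components. -/
lemma exists_critical_tutte_set [Finite W] (heven : Even (Nat.card W))
    (h : ∀ M : Γ.Subgraph, ¬ M.IsPerfectMatching) :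
    ∃ U : Set W, 2 * U.ncard + 2 ≤ (Γ.cutAt U).oddComponents.ncard ∧
      ∀ x ∈ U, ∀ c₁ c₂ : (Γ.cutAt U).ConnectedComponent, ∃ y, Γ.Adj x y ∧ y ∉ U ∧
        (Γ.cutAt U).connectedComponentMk y ≠ c₁ ∧ (Γ.cutAt U).connectedComponentMk y ≠ c₂ := by
  -- By parity a violation by one is a violation by two.
  have hpar : ∀ U : Set W, Even (Γ.cutAt U).oddComponents.ncard := fun U => by
    rw [← Nat.not_odd_iff_even, odd_ncard_oddComponents, Nat.not_odd_iff_even]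
    exact heven
  have hbump : ∀ U : Set W, 2 * U.ncard < (Γ.cutAt U).oddComponents.ncard →
      2 * U.ncard + 2 ≤ (Γ.cutAt U).oddComponents.ncard := fun U hU => by
    obtain ⟨k, hk⟩ := hpar U
    omega
  obtain ⟨U₀, hU₀⟩ := exists_isTutteViolator h heven
  obtain ⟨U, hU, hmin⟩ := Set.exists_min_image
    {U : Set W | 2 * U.ncard + 2 ≤ (Γ.cutAt U).oddComponents.ncard} Set.ncard (Set.toFinite _)
    ⟨U₀, hbump U₀ hU₀.two_mul_ncard_lt⟩
  refine ⟨U, hU, fun x hx c₁ c₂ => ?_⟩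
  by_contra! hcon
  have hle : Γ.cutAt U ≤ Γ.cutAt (U \ {x}) := fun a b hab =>
    ⟨hab.1, fun h => hab.2.1 h.1, fun h => hab.2.2 h.1⟩
  -- Returning `x` costs at most three odd components: its own singleton, `c₁` and `c₂`. At least
  -- 2|U| - 1 > 2(|U| - 1) remain, contradicting minimality of `U`.
  have h1 := ncard_oddComponents_le_add hle {(Γ.cutAt U).connectedComponentMk x, c₁, c₂} ?_
  · have h2 : ({(Γ.cutAt U).connectedComponentMk x, c₁, c₂} : Set _).ncard ≤ 3 := by
      refine (Set.ncard_insert_le _ _).trans ?_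
      have := Set.ncard_insert_le c₁ {c₂}
      rw [Set.ncard_singleton] at this
      omega
    have h3 := Set.ncard_sdiff_singleton_add_one hx (Set.toFinite _)
    have h4 : 2 * U.ncard + 2 ≤ (Γ.cutAt U).oddComponents.ncard := hU
    have h5 := hmin (U \ {x}) (hbump _ (by omega))
    omega
  · intro a b hab hnab
    rw [cutAt_adj] at hab hnab
    simp only [Set.mem_sdiff, Set.mem_singleton_iff, not_and, not_not] at hab
    by_cases ha : a ∈ U
    · exact Or.inl (by rw [hab.2.1 ha])
    · have hb : b ∈ U := by
        by_contra hb
        exact hnab ⟨hab.1, ha, hb⟩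
      have hbx := hab.2.2 hb
      subst hbx
      by_cases h1 : (Γ.cutAt U).connectedComponentMk a = c₁
      · exact Or.inr (Or.inl h1)
      · exact Or.inr (Or.inr (hcon a hab.1.symm ha h1))

end SimpleGraph

end

/-! ### A sufficient condition for f-factors through a perfect matching gadget. -/

section

open Finset

set_option linter.unusedSectionVars false

namespace SimpleGraph

variable {V : Type*} [Fintype V] [DecidableEq V] (G : SimpleGraph V) [DecidableRel G.Adj]
  (f : V → ℕ)

/-- The vertices of the gadget for `f`-factors: a port for each dart, and `deg v - f v` fillers
for each vertex `v`. -/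
abbrev GadgetVertex := G.Dart ⊕ (Σ v : V, Fin (G.degree v - f v))

/-- The gadget whose perfect matchings correspond to the `f`-factors of `G`: the ports of opposite
darts are adjacent, and the fillers at `v` are adjacent to the ports at `v`. -/
def factorGadget : SimpleGraph (GadgetVertex G f) where
  Adj
    | .inl d, .inl d' => d' = d.symm
    | .inl d, .inr w => d.fst = w.1
    | .inr w, .inl d => d.fst = w.1
    | .inr _, .inr _ => False
  symm := ⟨by
    rintro (d | w) (d' | w') h
    · change d = d'.symm
      change d' = d.symm at h
      rw [h, Dart.symm_symm]
    · exact h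
    · exact h
    · exact h⟩
  loopless := ⟨by
    rintro (d | w) h
    · exact d.symm_ne h.symm
    · exact h⟩

variable {G f}

@[simp] lemma factorGadget_inl_inl {d d' : G.Dart} :
    (factorGadget G f).Adj (.inl d) (.inl d') ↔ d' = d.symm := Iff.rfl

@[simp] lemma factorGadget_inl_inr {d : G.Dart} {w : Σ v : V, Fin (G.degree v - f v)} :
    (factorGadget G f).Adj (.inl d) (.inr w) ↔ d.fst = w.1 := Iff.rfl

@[simp] lemma factorGadget_inr_inl {d : G.Dart} {w : Σ v : V, Fin (G.degree v - f v)} :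
    (factorGadget G f).Adj (.inr w) (.inl d) ↔ d.fst = w.1 := Iff.rfl

@[simp] lemma factorGadget_inr_inr {w w' : Σ v : V, Fin (G.degree v - f v)} :
    ¬ (factorGadget G f).Adj (.inr w) (.inr w') := id

lemma card_dart_fst_mem (S : Finset V) :
    (univ.filter fun d : G.Dart => d.fst ∈ S).card = ∑ v ∈ S, G.degree v := by
  have hmaps : Set.MapsTo (fun d : G.Dart => d.fst)
      ((univ.filter fun d : G.Dart => d.fst ∈ S : Finset G.Dart) : Set G.Dart) S :=
    fun d hd => (mem_filter.1 (mem_coe.1 hd)).2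
  refine (card_eq_sum_card_fiberwise hmaps).trans ?_
  refine sum_congr rfl fun v hv => ?_
  rw [← dart_fst_fiber_card_eq_degree, filter_filter]
  congr 1
  ext d
  simp only [mem_filter, mem_univ, true_and, and_iff_right_iff_imp]
  rintro rfl
  exact hv

/-- The factor consists of the edges whose two ports are matched to each other. The deg v - f v
fillers at v take that many ports, which leaves f v. -/
lemma exists_factor_of_isPerfectMatching (hf : ∀ v, f v ≤ G.degree v)
    {M : (factorGadget G f).Subgraph} (hM : M.IsPerfectMatching) :
    ∃ F ⊆ G.edgeFinset, ∀ v, (F.filter (v ∈ ·)).card = f v := by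
  classical
  rw [Subgraph.isPerfectMatching_iff] at hM
  let A : Finset G.Dart := univ.filter fun d => M.Adj (.inl d) (.inl d.symm)
  have hA : ∀ d, d ∈ A ↔ M.Adj (.inl d) (.inl d.symm) := fun d => by simp [A]
  have hAsymm : ∀ d ∈ A, d.symm ∈ A := fun d hd => by
    rw [hA] at hd ⊢
    rw [Dart.symm_symm]
    exact hd.symm
  refine ⟨A.image Dart.edge, fun e he => ?_, fun v => ?_⟩
  · obtain ⟨d, -, rfl⟩ := mem_image.1 he
    rw [mem_edgeFinset]
    exact d.edge_mem
  have h1 : ((A.image Dart.edge).filter (v ∈ ·)).card = (A.filter (·.fst = v)).card := by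
    symm
    refine card_bij (fun d _ => d.edge) (fun d hd => ?_) (fun d hd d' hd' h => ?_) fun e he => ?_
    · obtain ⟨hdA, rfl⟩ := mem_filter.1 hd
      exact mem_filter.2 ⟨mem_image_of_mem _ hdA, Sym2.mem_mk_left _ _⟩
    · obtain h | h := (dart_edge_eq_iff d d').1 h
      · exact h
      · have h2 := (mem_filter.1 hd).2
        rw [h, ← (mem_filter.1 hd').2] at h2
        exact absurd h2.symm d'.fst_ne_snd
    · obtain ⟨he, hve⟩ := mem_filter.1 he
      obtain ⟨d, hd, rfl⟩ := mem_image.1 he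
      obtain h | h := Sym2.mem_iff.1 (show v ∈ s(d.fst, d.snd) from hve)
      · exact ⟨d, mem_filter.2 ⟨hd, h.symm⟩, rfl⟩
      · exact ⟨d.symm, mem_filter.2 ⟨hAsymm d hd, h.symm⟩, d.edge_symm⟩
  have h2 : (univ.filter fun d : G.Dart => d.fst = v ∧ d ∉ A).card = G.degree v - f v := by
    have hex : ∀ i : Fin (G.degree v - f v), ∃ d : G.Dart, d.fst = v ∧
        M.Adj (.inr ⟨v, i⟩) (.inl d) := fun i => by
      obtain ⟨y, hy, -⟩ := hM (.inr ⟨v, i⟩)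
      obtain d | w := y
      · exact ⟨d, factorGadget_inr_inl.1 hy.adj_sub, hy⟩
      · exact absurd hy.adj_sub factorGadget_inr_inr
    choose g hgv hgM using hex
    rw [← Fintype.card_fin (G.degree v - f v), ← card_univ]
    symm
    refine card_bij (fun i _ => g i) (fun i _ => ?_) (fun i _ j _ h => ?_) fun d hd => ?_
    · refine mem_filter.2 ⟨mem_univ _, hgv i, fun h => ?_⟩
      have := (hM (.inl (g i))).unique (hgM i).symm ((hA _).1 h)
      simp at this
    · have h3 := (hM (.inl (g i))).unique (hgM i).symm (h ▸ (hgM j).symm)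
      simpa using h3
    · obtain ⟨hdv, hdA⟩ := (mem_filter.1 hd).2
      obtain ⟨y, hy, -⟩ := hM (.inl d)
      obtain d' | ⟨w, i⟩ := y
      · obtain rfl : d' = d.symm := factorGadget_inl_inl.1 hy.adj_sub
        exact absurd ((hA d).2 hy) hdA
      · obtain rfl : v = w := hdv.symm.trans (factorGadget_inl_inr.1 hy.adj_sub)
        refine ⟨i, mem_univ _, ?_⟩
        have := (hM (.inr ⟨v, i⟩)).unique (hgM i) hy.symm
        simpa using this
  have h3 := dart_fst_fiber_card_eq_degree G v
  rw [← card_filter_add_card_filter_not (fun d => d ∈ A), filter_filter, filter_filter, h2] at h3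
  have h4 : (univ.filter fun d : G.Dart => d.fst = v ∧ d ∈ A) = A.filter (·.fst = v) := by
    ext d
    simp [and_comm]
  rw [h4] at h3
  have := hf v
  omega

lemma even_card_gadgetVertex (hf : ∀ v, f v ≤ G.degree v) (heven : Even (∑ v, f v)) :
    Even (Nat.card (GadgetVertex G f)) := by
  rw [Nat.card_eq_fintype_card, Fintype.card_sum, dart_card_eq_sum_degrees, Fintype.card_sigma]
  simp only [Fintype.card_fin]
  have h1 : ∑ v, (G.degree v - f v) + ∑ v, f v = ∑ v, G.degree v := by
    rw [← sum_add_distrib]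
    exact sum_congr rfl fun v _ => Nat.sub_add_cancel (hf v)
  have h2 : Even (∑ v, G.degree v) := by
    rw [sum_degrees_eq_twice_card_edges]
    exact even_two_mul _
  have h3 : Even (∑ v, (G.degree v - f v)) := (Nat.even_add.1 (h1 ▸ h2)).2 heven
  exact h2.add h3

open Classical in
/-- A sufficient condition for the existence of an `f`-factor. -/
theorem exists_factor (hf : ∀ v, f v ≤ G.degree v) (hpos : ∀ v, 0 < G.degree v)
    (heven : Even (∑ v, f v))
    (h : ∀ (S T A : Finset V) (p : V → Finset V), Disjoint S T →
      SparseEdges.IsSeparated G.edgeFinset (S ∪ T) A p →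
      A.card + (univ.filter fun d : G.Dart => d.fst ∈ T ∧ d.snd ∈ S).card <
        ∑ v ∈ S, f v + ∑ v ∈ T, (G.degree v - f v) + 2) :
    ∃ F ⊆ G.edgeFinset, ∀ v, (F.filter (v ∈ ·)).card = f v := by
  by_contra hcon
  obtain ⟨U, hU, hcrit⟩ := exists_critical_tutte_set (even_card_gadgetVertex hf heven)
    fun M hM => hcon (exists_factor_of_isPerfectMatching hf hM)
  set H := (factorGadget G f).cutAt U
  set mk := H.connectedComponentMk
  have hmk : ∀ {a b}, (factorGadget G f).Adj a b → a ∉ U → b ∉ U → mk a = mk b :=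
    fun hab ha hb => ConnectedComponent.eq.2 (Adj.reachable ⟨hab, ha, hb⟩)
  -- Fillers at one vertex are twins: the neighbours outside `U` of a filler in `U` would all lie in
  -- the component of a twin outside `U`.
  have hfill : ∀ v i j, (.inr ⟨v, i⟩ : GadgetVertex G f) ∈ U →
      (.inr ⟨v, j⟩ : GadgetVertex G f) ∈ U := by
    intro v i j hi
    by_contra hj
    obtain ⟨y, hy, hyU, hne, -⟩ := hcrit _ hi (mk (.inr ⟨v, j⟩)) (mk (.inr ⟨v, j⟩))
    obtain d | w := y
    · exact hne (hmk (factorGadget_inl_inr.2 (factorGadget_inr_inl.1 hy)) hyU hj)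
    · exact factorGadget_inr_inr hy
  -- A port sees only its opposite port and the fillers at its vertex, while criticality demands
  -- neighbours in at least three components. So no filler there lies in `U`, and no other port
  -- there can stay outside.
  have hport : ∀ d, (.inl d : GadgetVertex G f) ∈ U →
      (∀ i, (.inr ⟨d.fst, i⟩ : GadgetVertex G f) ∉ U) ∧
      ∀ d', d'.fst = d.fst → (.inl d' : GadgetVertex G f) ∈ U := by
    intro d hd
    have h1 : ∀ i, (.inr ⟨d.fst, i⟩ : GadgetVertex G f) ∉ U := by
      intro i hi
      obtain ⟨y, hy, hyU, hne, -⟩ := hcrit _ hd (mk (.inl d.symm)) (mk (.inl d.symm))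
      obtain d' | ⟨w, j⟩ := y
      · exact hne (by rw [factorGadget_inl_inl.1 hy])
      · obtain rfl : d.fst = w := factorGadget_inl_inr.1 hy
        exact hyU (hfill _ i j hi)
    refine ⟨h1, fun d' hd' => ?_⟩
    by_contra hdU
    obtain ⟨y, hy, hyU, hne, hne'⟩ := hcrit _ hd (mk (.inl d.symm)) (mk (.inl d'))
    obtain d'' | ⟨w, j⟩ := y
    · exact hne (by rw [factorGadget_inl_inl.1 hy])
    · refine hne' (hmk (factorGadget_inr_inl.2 ?_) hyU hdU)
      rw [hd', factorGadget_inl_inr.1 hy]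
  let S : Finset V := univ.filter fun v => ∃ d : G.Dart, d.fst = v ∧
    (.inl d : GadgetVertex G f) ∈ U
  -- A vertex outside `S` without fillers, where f v = deg v, satisfies this vacuously and belongs
  -- to `T`.
  let T : Finset V := univ.filter fun v => v ∉ S ∧ ∀ i, (.inr ⟨v, i⟩ : GadgetVertex G f) ∈ U
  have hS : ∀ d : G.Dart, d.fst ∈ S ↔ (.inl d : GadgetVertex G f) ∈ U := fun d => by
    refine ⟨fun hd => ?_, fun hd => mem_filter.2 ⟨mem_univ _, d, rfl, hd⟩⟩
    obtain ⟨d', hd', hU'⟩ := (mem_filter.1 hd).2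
    exact (hport d' hU').2 d hd'.symm
  have hT : ∀ v, v ∈ T ↔ v ∉ S ∧ ∀ i, (.inr ⟨v, i⟩ : GadgetVertex G f) ∈ U := fun v => by
    simp only [T, mem_filter, mem_univ, true_and]
  have hC : ∀ v, v ∉ S → v ∉ T → ∀ i, (.inr ⟨v, i⟩ : GadgetVertex G f) ∉ U := fun v h1 h2 i hi =>
    h2 ((hT v).2 ⟨h1, fun j => hfill v i j hi⟩)
  have hCex : ∀ v, v ∉ S → v ∉ T → ∃ i, (.inr ⟨v, i⟩ : GadgetVertex G f) ∉ U := fun v h1 h2 => by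
    by_contra! h3
    exact h2 ((hT v).2 ⟨h1, h3⟩)
  have hdart : ∀ v, ∃ d : G.Dart, d.fst = v := fun v => by
    obtain ⟨w, hw⟩ := (G.degree_pos_iff_exists_adj v).1 (hpos v)
    exact ⟨⟨(v, w), hw⟩, rfl⟩
  choose port hport' using hdart
  let comp : V → H.ConnectedComponent := fun v => mk (.inl (port v))
  have hcomp_fill : ∀ v, v ∉ S → v ∉ T → ∀ i, mk (.inr ⟨v, i⟩) = comp v := fun v h1 h2 i =>
    hmk (factorGadget_inr_inl.2 (hport' v)) (hC v h1 h2 i)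
      (fun h => h1 (hport' v ▸ (hS _).2 h))
  have hcomp_port : ∀ d : G.Dart, d.fst ∉ S → d.fst ∉ T → mk (.inl d) = comp d.fst := by
    intro d h1 h2
    obtain ⟨i, hi⟩ := hCex _ h1 h2
    rw [← hcomp_fill _ h1 h2 i]
    exact hmk (factorGadget_inl_inr.2 rfl) (fun h => h1 ((hS _).2 h)) hi
  have hcomp_adj : ∀ x y, G.Adj x y → x ∉ S → x ∉ T → y ∉ S → y ∉ T → comp x = comp y := by
    intro x y hxy hx hx' hy hy'
    let d : G.Dart := ⟨(x, y), hxy⟩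
    have h1 := hcomp_port d hx hx'
    have h2 := hcomp_port d.symm hy hy'
    exact h1.symm.trans ((hmk (factorGadget_inl_inl.2 rfl) (fun h => hx ((hS d).2 h))
      (fun h => hy ((hS d.symm).2 h))).trans h2)
  let C : Finset V := univ.filter fun v => v ∉ S ∪ T
  obtain ⟨A, hAC, hinj, himg⟩ :=
    Finset.exists_subset_injOn_image_eq_of_surjOn (f := comp) C (C.image comp) (fun c hc => by
      simpa using hc)
  have hsep : SparseEdges.IsSeparated G.edgeFinset (S ∪ T) A
      (fun v => C.filter fun w => comp w = comp v) := by
    refine ⟨fun a ha => (mem_filter.1 (hAC ha)).2, fun a ha b hb hab => ?_,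
      fun a ha x y hxy hx hy hxa => ?_⟩
    · have h1 : a ∈ C.filter fun w => comp w = comp a := mem_filter.2 ⟨hAC ha, rfl⟩
      have h2 : a ∈ C.filter fun w => comp w = comp b := by
        have h3 : (C.filter fun w => comp w = comp a) = C.filter fun w => comp w = comp b := hab
        rwa [← h3]
      exact hinj ha hb (mem_filter.1 h2).2
    · rw [mem_edgeFinset, mem_edgeSet] at hxy
      simp only [mem_union, not_or] at hx hy
      have := hcomp_adj x y hxy hx.1 hx.2 hy.1 hy.2
      change (C.filter fun w => comp w = comp y) = _
      rw [← this]
      exact hxa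
  have hST : Disjoint S T := Finset.disjoint_left.2 fun _ h1 h2 => ((hT _).1 h2).1 h1
  have hfin := h S T A _ hST hsep
  let E : Finset G.Dart := univ.filter fun d : G.Dart => d.fst ∈ T ∧ d.snd ∈ S
  -- The odd components come from vertices of `U`, from fillers at `S`, from ports at `T` facing
  -- `S`, and from components of G - (S ∪ T), which `A` represents. Two opposite ports both at `T`
  -- form a component of size two, which is even.
  have hodd : H.oddComponents ⊆ mk '' U ∪ mk '' (Sum.inr '' ↑(S.sigma fun v =>
      (univ : Finset (Fin (G.degree v - f v))))) ∪ mk '' (Sum.inl '' (E : Set G.Dart)) ∪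
      ((A.image comp : Finset H.ConnectedComponent) : Set H.ConnectedComponent) := by
    have hinC : ∀ v, v ∉ S → v ∉ T → comp v ∈ ((A.image comp : Finset H.ConnectedComponent) : Set H.ConnectedComponent) := by
      intro v h1 h2
      rw [himg]
      exact mem_coe.2 (mem_image_of_mem _ (mem_filter.2 ⟨mem_univ _, by simp [h1, h2]⟩))
    intro c hc
    induction c using ConnectedComponent.ind with | h z =>
    by_cases hz : z ∈ U
    · exact Or.inl (Or.inl (Or.inl ⟨z, hz, rfl⟩))
    obtain d | ⟨v, i⟩ := z
    · have h1 : d.fst ∉ S := fun h => hz ((hS d).1 h)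
      by_cases h2 : d.fst ∈ T
      swap
      · right
        change mk _ ∈ _
        rw [hcomp_port d h1 h2]
        exact hinC _ h1 h2
      by_cases h3 : d.snd ∈ S
      · exact Or.inl (Or.inr ⟨_, ⟨d, mem_coe.2 (mem_filter.2 ⟨mem_univ _, h2, h3⟩), rfl⟩, rfl⟩)
      have hz' : (.inl d.symm : GadgetVertex G f) ∉ U := fun h => h3 ((hS d.symm).2 h)
      by_cases h4 : d.snd ∈ T
      swap
      · right
        change mk _ ∈ _
        rw [hmk (factorGadget_inl_inl.2 rfl) hz hz', hcomp_port d.symm h3 h4]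
        exact hinC _ h3 h4
      exfalso
      have hsupp : (mk (.inl d)).supp = {.inl d, .inl d.symm} := by
        refine supp_connectedComponentMk_eq (Or.inl rfl) ?_ ?_
        · rintro a b ha ⟨hab, haU, hbU⟩
          have key : ∀ d : G.Dart, d.fst ∈ T → ∀ b, (factorGadget G f).Adj (.inl d) b → b ∉ U →
              b = .inl d.symm := by
            rintro d hd (d' | ⟨w, i⟩) hadj hb
            · rw [factorGadget_inl_inl.1 hadj]
            · obtain rfl : d.fst = w := factorGadget_inl_inr.1 hadj
              exact absurd (((hT _).1 hd).2 i) hb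
          obtain rfl | rfl := ha
          · exact Or.inr (key d h2 b hab hbU)
          · left
            rw [key d.symm h4 b hab hbU, Dart.symm_symm]
        · rintro b (rfl | rfl)
          · exact Reachable.refl _
          · exact Adj.reachable ⟨factorGadget_inl_inl.2 rfl, hz, hz'⟩
      have hc' : Odd (mk (.inl d)).supp.ncard := hc
      rw [hsupp, Set.ncard_pair] at hc'
      · exact absurd hc' (by decide)
      · exact fun h => d.symm_ne (Sum.inl_injective h).symm
    · by_cases h1 : v ∈ S
      · exact Or.inl (Or.inl (Or.inr ⟨_, ⟨⟨v, i⟩, by simp [h1], rfl⟩, rfl⟩))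
      · have h2 : v ∉ T := fun h => hz (((hT v).1 h).2 i)
        right
        change mk _ ∈ _
        rw [hcomp_fill v h1 h2]
        exact hinC _ h1 h2
  have hcard := (Set.ncard_le_ncard hodd (Set.toFinite _)).trans ((Set.ncard_union_le _ _).trans
    (Nat.add_le_add_right ((Set.ncard_union_le _ _).trans
      (Nat.add_le_add_right (Set.ncard_union_le _ _) _)) _))
  have hc1 : (mk '' U).ncard ≤ U.ncard := Set.ncard_image_le (Set.toFinite _)
  have hc2 : (mk '' (Sum.inr '' ↑(S.sigma fun v =>
      (univ : Finset (Fin (G.degree v - f v)))))).ncard ≤ ∑ v ∈ S, (G.degree v - f v) := by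
    refine (Set.ncard_image_le (Set.toFinite _)).trans
      ((Set.ncard_image_le (Set.toFinite _)).trans ?_)
    rw [Set.ncard_coe_finset, card_sigma]
    simp
  have hc3 : (mk '' (Sum.inl '' (E : Set G.Dart))).ncard ≤ E.card := by
    refine (Set.ncard_image_le (Set.toFinite _)).trans
      ((Set.ncard_image_le (Set.toFinite _)).trans ?_)
    rw [Set.ncard_coe_finset]
  have hc4 : (((A.image comp : Finset H.ConnectedComponent) : Set H.ConnectedComponent)).ncard ≤ A.card := by
    rw [Set.ncard_coe_finset]
    exact card_image_le
  have hc5 : ∑ v ∈ S, G.degree v + ∑ v ∈ T, (G.degree v - f v) ≤ U.ncard := by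
    have h1 : ((univ.filter fun d : G.Dart => d.fst ∈ S).disjSum (T.sigma fun v =>
        (univ : Finset (Fin (G.degree v - f v))))).card =
        ∑ v ∈ S, G.degree v + ∑ v ∈ T, (G.degree v - f v) := by
      rw [card_disjSum, card_dart_fst_mem, card_sigma]
      simp
    rw [← h1, ← Set.ncard_coe_finset]
    refine Set.ncard_le_ncard ?_ (Set.toFinite _)
    rintro (d | ⟨v, i⟩) hx
    · rw [mem_coe, inl_mem_disjSum] at hx
      exact (hS d).1 (mem_filter.1 hx).2
    · rw [mem_coe, inr_mem_disjSum, mem_sigma] at hx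
      exact ((hT v).1 hx.1).2 i
  have hc6 : ∑ v ∈ S, (G.degree v - f v) + ∑ v ∈ S, f v = ∑ v ∈ S, G.degree v := by
    rw [← sum_add_distrib]
    exact sum_congr rfl fun v _ => Nat.sub_add_cancel (hf v)
  have hE : E.card = (univ.filter fun d : G.Dart => d.fst ∈ T ∧ d.snd ∈ S).card := rfl
  omega

end SimpleGraph

end

/-! ### A factor that is regular up to one vertex. -/

section

open Finset

set_option linter.unusedSectionVars false

namespace SimpleGraph

variable {V : Type*} [Fintype V] [DecidableEq V] {G : SimpleGraph V} [DecidableRel G.Adj]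
  {S A : Finset V} {r : ℕ}

/-- A greedily chosen independent set carries a large part of a degree-dependent weight. -/
lemma exists_indep_weight_ge (hr : 2 ≤ r) (hAS : Disjoint A S)
    (hA : ∀ v ∈ A, (G.neighborFinset v \ S).card ≤ r) :
    ∃ I ⊆ A, (∀ a ∈ I, ∀ b ∈ I, ¬ G.Adj a b) ∧
      ∑ v ∈ A, (2 * (r : ℤ) + 1 - 2 * (G.neighborFinset v \ S).card) ≤
        (2 * (r : ℤ) - 1) * ∑ v ∈ I, ((r : ℤ) + 1 - (G.neighborFinset v \ S).card) := by
  induction A using Finset.strongInduction with | H A ih =>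
  obtain rfl | hne := A.eq_empty_or_nonempty
  · exact ⟨∅, Subset.rfl, by simp, by simp⟩
  -- Greedy choice of `v` with the fewest neighbours d outside `S`. It discards at most d + 1
  -- vertices of weight at most 2r + 1 - 2d, and (2r - 1)(r + 1 - d) exceeds (d + 1)(2r + 1 - 2d) by
  -- 2(r - d)(r - d - 1) + r - 2, which is nonnegative for integers with r ≥ 2.
  obtain ⟨v, hv, hmin⟩ := exists_min_image A (fun v => (G.neighborFinset v \ S).card) hne
  set N := insert v (G.neighborFinset v \ S)
  have hvN : v ∈ N := mem_insert_self _ _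
  have hsub : A \ N ⊆ A := sdiff_subset
  obtain ⟨I, hI, hind, hsum⟩ := ih (A \ N)
    ⟨hsub, fun h => (mem_sdiff.1 (h hv)).2 hvN⟩
    (hAS.mono_left hsub) fun w hw => hA w (hsub hw)
  have hvI : v ∉ I := fun h => (mem_sdiff.1 (hI h)).2 hvN
  have hnadj : ∀ b ∈ I, ¬ G.Adj v b := fun b hb hvb => by
    obtain ⟨hbA, hbN⟩ := mem_sdiff.1 (hI hb)
    exact hbN (mem_insert_of_mem (mem_sdiff.2
      ⟨(G.mem_neighborFinset v b).2 hvb, Finset.disjoint_left.1 hAS hbA⟩))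
  refine ⟨insert v I, insert_subset hv (hI.trans hsub), fun a ha b hb => ?_, ?_⟩
  · obtain rfl | ha' := mem_insert.1 ha
    · obtain rfl | hb' := mem_insert.1 hb
      · exact G.irrefl
      · exact hnadj b hb'
    · obtain rfl | hb' := mem_insert.1 hb
      · exact fun h => hnadj a ha' h.symm
      · exact hind a ha' b hb'
  · rw [sum_insert hvI, mul_add, ← sum_sdiff (inter_subset_left : A ∩ N ⊆ A), sdiff_inter_self_left,
      add_comm]
    refine add_le_add ?_ hsum
    have h1 := sum_le_card_nsmul (A ∩ N)
      (fun w => 2 * (r : ℤ) + 1 - 2 * (G.neighborFinset w \ S).card)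
      (2 * (r : ℤ) + 1 - 2 * (G.neighborFinset v \ S).card) fun w hw => by
        have := hmin w (mem_inter.1 hw).1
        omega
    rw [nsmul_eq_mul] at h1
    have h2 : (A ∩ N).card ≤ (G.neighborFinset v \ S).card + 1 :=
      (card_le_card inter_subset_right).trans (card_insert_le _ _)
    have h3 := hA v hv
    generalize (G.neighborFinset v \ S).card = d at h1 h2 h3 ⊢
    have h4 : ((A ∩ N).card : ℤ) ≤ d + 1 := by exact_mod_cast h2
    have h5 : (d : ℤ) ≤ r := by exact_mod_cast h3
    have h6 : (2 : ℤ) ≤ r := by exact_mod_cast hr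
    have h7 : (0 : ℤ) ≤ d := by positivity
    refine h1.trans ((mul_le_mul_of_nonneg_right h4 (by linarith)).trans ?_)
    nlinarith [mul_nonneg (sub_nonneg.2 h5) (sub_nonneg.2 h6), mul_nonneg h7 (sub_nonneg.2 h5),
      mul_nonneg (sub_nonneg.2 h5) (sub_nonneg.2 h5)]

/-- Vertices with more than r neighbours outside `S` have negative weight and are dropped. For the
independent set `I` chosen among the rest, deleting `S` and the neighbours of `I` isolates `I`, so
`hiso` bounds the right side of the greedy estimate. -/
lemma sum_weights_le_of_iso (hr : 2 ≤ r) (hST : Disjoint S A)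
    (hiso : ∀ I T : Finset V, Disjoint I T → (∀ a ∈ I, ∀ w, G.Adj a w → w ∈ T) →
      (r + 1) * I.card ≤ T.card) :
    ∑ v ∈ A, (2 * (r : ℤ) + 1 - 2 * (G.neighborFinset v \ S).card) ≤
      (2 * (r : ℤ) - 1) * S.card := by
  have hr' : (2 : ℤ) ≤ r := by exact_mod_cast hr
  set A' := A.filter fun v => (G.neighborFinset v \ S).card ≤ r
  have h1 : ∑ v ∈ A, (2 * (r : ℤ) + 1 - 2 * (G.neighborFinset v \ S).card) ≤
      ∑ v ∈ A', (2 * (r : ℤ) + 1 - 2 * (G.neighborFinset v \ S).card) := by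
    rw [sum_filter]
    refine sum_le_sum fun v _ => ?_
    split_ifs with h
    · exact le_rfl
    · omega
  obtain ⟨I, hI, hind, hsum⟩ := exists_indep_weight_ge (A := A') hr
    (hST.symm.mono_left (filter_subset _ _)) fun v hv => (mem_filter.1 hv).2
  have h2 := hiso I (S ∪ I.biUnion fun v => G.neighborFinset v \ S) (by
    rw [Finset.disjoint_left]
    intro a ha haT
    obtain h | h := mem_union.1 haT
    · exact Finset.disjoint_left.1 hST h (mem_filter.1 (hI ha)).1
    · obtain ⟨b, hb, hab⟩ := mem_biUnion.1 h
      exact hind b hb a ha ((G.mem_neighborFinset b a).1 (mem_sdiff.1 hab).1)) (by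
    intro a ha w haw
    by_cases hw : w ∈ S
    · exact mem_union_left _ hw
    · exact mem_union_right _ (mem_biUnion.2
        ⟨a, ha, mem_sdiff.2 ⟨(G.mem_neighborFinset a w).2 haw, hw⟩⟩))
  have h3 := h2.trans ((card_union_le _ _).trans (Nat.add_le_add_left card_biUnion_le _))
  have h4 : ∑ v ∈ I, ((r : ℤ) + 1 - (G.neighborFinset v \ S).card) ≤ S.card := by
    rw [sum_sub_distrib, sum_const, nsmul_eq_mul]
    have : ((r : ℤ) + 1) * I.card ≤ S.card + ∑ v ∈ I, ((G.neighborFinset v \ S).card : ℤ) := by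
      exact_mod_cast h3
    linarith
  exact h1.trans (hsum.trans (mul_le_mul_of_nonneg_left h4 (by linarith)))

lemma card_dart_fst_mem_snd_mem_le (S T : Finset V) :
    (univ.filter fun d : G.Dart => d.fst ∈ T ∧ d.snd ∈ S).card ≤
      ∑ v ∈ T, (G.neighborFinset v ∩ S).card := by
  have hmaps : Set.MapsTo (fun d : G.Dart => d.fst)
      ((univ.filter fun d : G.Dart => d.fst ∈ T ∧ d.snd ∈ S : Finset G.Dart) : Set G.Dart) T :=
    fun d hd => (mem_filter.1 (mem_coe.1 hd)).2.1
  refine (card_eq_sum_card_fiberwise hmaps).trans_le (sum_le_sum fun v _ => ?_)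
  refine card_le_card_of_injOn (fun d => d.snd) (fun d hd => ?_) fun d hd d' hd' h => ?_
  · obtain ⟨h1, rfl⟩ := mem_filter.1 (mem_coe.1 hd)
    exact mem_coe.2 (mem_inter.2 ⟨(G.mem_neighborFinset _ _).2 d.adj, (mem_filter.1 h1).2.2⟩)
  · have h1 := (mem_filter.1 (mem_coe.1 hd)).2
    have h2 := (mem_filter.1 (mem_coe.1 hd')).2
    exact Dart.ext _ _ (Prod.ext (h1.trans h2.symm) h)

/-- A graph satisfying an isolated-vertex condition and a component condition has a factor that is
`r`-regular except possibly for one vertex of degree `r + 1`. -/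
theorem exists_nearly_regular_factor {τ : ℝ} (hr : 2 ≤ r) (hτ : 2 < τ)
    (hcomp : SparseEdges.FewComponents τ G.edgeFinset)
    (hiso : ∀ I T : Finset V, Disjoint I T → (∀ a ∈ I, ∀ w, G.Adj a w → w ∈ T) →
      (r + 1) * I.card ≤ T.card) :
    ∃ Q : Finset V, Q.card ≤ 1 ∧ ∃ F ⊆ G.edgeFinset,
      ∀ v, (F.filter (v ∈ ·)).card = r + if v ∈ Q then 1 else 0 := by
  have hdeg : ∀ v, r + 1 ≤ G.degree v := fun v => by
    have := hiso {v} (G.neighborFinset v) (by simp) (by simp)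
    rwa [card_singleton, mul_one, card_neighborFinset_eq_degree] at this
  -- One exceptional vertex repairs the parity of the degree sum.
  obtain ⟨Q, hQ, heven⟩ : ∃ Q : Finset V, Q.card ≤ 1 ∧ Even (r * Fintype.card V + Q.card) := by
    by_cases h : Even (r * Fintype.card V)
    · exact ⟨∅, by simp, by simpa using h⟩
    · have hV : Nonempty V := by
        by_contra hV
        rw [not_nonempty_iff] at hV
        simp at h
      refine ⟨{Classical.arbitrary V}, by simp, ?_⟩
      rw [card_singleton]
      exact (Nat.not_even_iff_odd.1 h).add_one
  refine ⟨Q, hQ, exists_factor (fun v => ?_) (fun v => ?_) ?_ ?_⟩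
  · have := hdeg v
    split_ifs <;> omega
  · have := hdeg v
    omega
  · rw [sum_add_distrib, sum_const, smul_eq_mul, card_univ, mul_comm]
    simpa using heven
  intro S T A p hST hsep
  have h1 := card_dart_fst_mem_snd_mem_le (G := G) S T
  have h2 := sum_weights_le_of_iso hr hST hiso
  have h3 := hcomp _ _ _ hsep
  rw [card_union_of_disjoint hST] at h3
  have h4 : ∑ v ∈ T, (G.neighborFinset v ∩ S).card + ∑ v ∈ T, (G.neighborFinset v \ S).card =
      ∑ v ∈ T, G.degree v := by
    rw [← sum_add_distrib]
    refine sum_congr rfl fun v _ => ?_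
    rw [card_inter_add_card_sdiff, card_neighborFinset_eq_degree]
  have h5 : ∑ v ∈ T, (G.degree v - (r + if v ∈ Q then 1 else 0)) + (T.card * r + (T ∩ Q).card) =
      ∑ v ∈ T, G.degree v := by
    have : T.card * r + (T ∩ Q).card = ∑ v ∈ T, (r + if v ∈ Q then 1 else 0) := by
      simp [sum_add_distrib]
    rw [this, ← sum_add_distrib]
    refine sum_congr rfl fun v _ => Nat.sub_add_cancel ?_
    have := hdeg v
    split_ifs <;> omega
  have h6 : S.card * r ≤ ∑ v ∈ S, (r + if v ∈ Q then 1 else 0) := by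
    rw [← smul_eq_mul]
    exact card_nsmul_le_sum _ _ _ fun v _ => Nat.le_add_right _ _
  have h7 : (T ∩ Q).card ≤ 1 := (card_le_card inter_subset_right).trans hQ
  rw [sum_sub_distrib, sum_const, nsmul_eq_mul, ← mul_sum] at h2
  have h8 : ∑ v ∈ T, ((G.neighborFinset v \ S).card : ℤ) =
      ((∑ v ∈ T, (G.neighborFinset v \ S).card : ℕ) : ℤ) := by push_cast; rfl
  rw [h8] at h2
  -- For nonempty S ∪ T, τ > 2 gives the strict bound |A| < (|S| + |T|)/2 + 1. Half of the weight
  -- inequality `h2` supplies exactly the missing (|S| + |T|)/2, and the slack 2 absorbs this 1 and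
  -- the possible vertex of `Q` in T. For S ∪ T empty the strict bound is not available, but |A| ≤ 1
  -- suffices.
  obtain h0 | h0 := Nat.eq_zero_or_pos (S.card + T.card)
  · have hA : A.card ≤ 1 := by
      rw [h0] at h3
      simpa using h3
    have hT : T = ∅ := card_eq_zero.1 (by omega)
    subst hT
    simp only [sum_empty] at *
    simp only [notMem_empty, false_and, filter_false, card_empty]
    omega
  · have h9 : 2 * A.card < S.card + T.card + 2 := by
      have h0' : (0 : ℝ) < S.card + T.card := by exact_mod_cast h0
      have : 2 * (((S.card : ℝ) + T.card) / τ) < S.card + T.card := by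
        rw [← mul_div_assoc, div_lt_iff₀ (by linarith)]
        nlinarith
      have : (2 * A.card : ℝ) < S.card + T.card + 2 := by
        push_cast at h3
        linarith
      exact_mod_cast this
    generalize ∑ v ∈ T, (G.neighborFinset v \ S).card = a at *
    generalize ∑ v ∈ T, (G.neighborFinset v ∩ S).card = b at *
    generalize ∑ v ∈ T, (G.degree v - (r + if v ∈ Q then 1 else 0)) = c at *
    generalize ∑ v ∈ T, G.degree v = d at *
    generalize ∑ v ∈ S, (r + if v ∈ Q then 1 else 0) = e at *
    zify at *
    nlinarith

end SimpleGraph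

end

/-! ### Transfer between multigraphs and their underlying simple graphs. -/

section

set_option linter.unusedSectionVars false

namespace Graph

variable {α β : Type*} {G : Graph α β}

lemma ncard_val_image (T : Finset G.vertexSet) :
    (Subtype.val '' (T : Set G.vertexSet)).ncard = T.card := by
  rw [Set.ncard_image_of_injective _ Subtype.val_injective, Set.ncard_coe_finset]

lemma val_mem_image_iff {T : Finset G.vertexSet} {v : G.vertexSet} :
    v.1 ∈ Subtype.val '' (T : Set G.vertexSet) ↔ v ∈ T := by
  rw [Subtype.val_injective.mem_set_image, Finset.mem_coe]

-- The labels of the separated vertices are constant along walks in G - T, so these vertices lie in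
-- distinct components.
open Classical in
lemma fewComponents_of_numComponents_le [Fintype G.vertexSet] [G.Loopless] {τ : ℝ}
    (h : ∀ S ⊆ G.vertexSet, ((G.deleteVerts S).numComponents : ℝ) ≤
      1 / τ * (S.ncard : ℝ) + 1) :
    SparseEdges.FewComponents τ G.toSimpleGraph.edgeFinset := by
  intro T A p hsep
  have hS : Subtype.val '' (T : Set G.vertexSet) ⊆ G.vertexSet := by
    rintro _ ⟨v, -, rfl⟩
    exact v.2
  have h1 := h _ hS
  set K := G.deleteVerts (Subtype.val '' (T : Set G.vertexSet))
  have hK : ∀ v : G.vertexSet, v ∉ T → v.1 ∈ K.vertexSet := fun v hv => by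
    rw [vertexSet_deleteVerts]
    exact ⟨v.2, fun h => hv (val_mem_image_iff.1 h)⟩
  have hKsub : K.vertexSet ⊆ G.vertexSet \ Subtype.val '' (T : Set G.vertexSet) := by
    rw [vertexSet_deleteVerts]
  let lab : K.vertexSet → Finset G.vertexSet := fun x => p ⟨x.1, (hKsub x.2).1⟩
  have hlab : ∀ a ∈ A, ∀ x y, K.toSimpleGraph.Reachable x y → lab x = p a → lab y = p a := by
    rintro a ha x y ⟨w⟩
    induction w with
    | nil => exact id
    | cons hadj _ ih =>
      rename_i x y z _
      refine fun hx => ih ?_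
      obtain ⟨-, e, he⟩ := hadj
      rw [deleteVerts_isLink] at he
      obtain ⟨he, hx', hy'⟩ := he
      refine hsep.eq_of_mem a ha ⟨x.1, (hKsub x.2).1⟩ ⟨y.1, (hKsub y.2).1⟩ ?_
        (fun h => hx' (val_mem_image_iff.2 h)) (fun h => hy' (val_mem_image_iff.2 h)) hx
      rw [SimpleGraph.mem_edgeFinset, SimpleGraph.mem_edgeSet, toSimpleGraph_adj_iff]
      exact ⟨e, he⟩
  have hfin : Finite K.vertexSet :=
    Set.Finite.subset (Set.toFinite G.vertexSet) fun x hx => (hKsub hx).1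
  have hle : A.card ≤ K.numComponents := by
    rw [← Fintype.card_coe A, ← Nat.card_eq_fintype_card]
    refine Nat.card_le_card_of_injective
      (fun a : A => K.toSimpleGraph.connectedComponentMk ⟨a.1.1, hK _ (hsep.notMem _ a.2)⟩) ?_
    intro a b hab
    refine Subtype.ext (hsep.injOn a.2 b.2 ?_)
    exact (hlab a a.2 _ _ (SimpleGraph.ConnectedComponent.eq.1 hab) rfl).symm
  rw [ncard_val_image] at h1
  calc (A.card : ℝ) ≤ K.numComponents := by exact_mod_cast hle
    _ ≤ 1 / τ * T.card + 1 := h1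
    _ = T.card / τ + 1 := by ring

lemma IsIsoTough.mul_card_le [Fintype G.vertexSet] [G.Loopless] {r : ℕ}
    (h : G.IsIsoTough ((r : ℝ) + 1)) (I T : Finset G.vertexSet) (hIT : Disjoint I T)
    (hI : ∀ a ∈ I, ∀ w, G.toSimpleGraph.Adj a w → w ∈ T) : (r + 1) * I.card ≤ T.card := by
  have hS : Subtype.val '' (T : Set G.vertexSet) ⊆ G.vertexSet := by
    rintro _ ⟨v, -, rfl⟩
    exact v.2
  have h1 := h _ hS
  have h2 : I.card ≤ (G.deleteVerts (Subtype.val '' (T : Set G.vertexSet))).numIsolated := by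
    rw [← ncard_val_image I]
    refine Set.ncard_le_ncard ?_ ((Set.toFinite G.vertexSet).subset ?_)
    · rintro _ ⟨v, hv, rfl⟩
      refine ⟨?_, ?_⟩
      · rw [vertexSet_deleteVerts]
        exact ⟨v.2, fun h => Finset.disjoint_left.1 hIT hv (val_mem_image_iff.1 h)⟩
      · rintro e ⟨y, hy⟩
        rw [deleteVerts_isLink] at hy
        exact hy.2.2 (val_mem_image_iff (v := ⟨y, hy.1.right_mem⟩).2
          (hI v hv _ ((toSimpleGraph_adj_iff _ _).2 ⟨e, hy.1⟩)))
    · rintro v ⟨hv, -⟩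
      rw [vertexSet_deleteVerts] at hv
      exact hv.1
  rw [ncard_val_image, one_div, inv_mul_eq_div, le_div_iff₀ (by positivity)] at h1
  have h3 : ((r : ℝ) + 1) * I.card ≤ T.card := by
    refine le_trans ?_ h1
    rw [mul_comm]
    exact mul_le_mul_of_nonneg_right (by exact_mod_cast h2) (by positivity)
  exact_mod_cast h3

/-- A choice of one edge of `G` for each pair of adjacent vertices. -/
lemma exists_edge_choice [G.Loopless] :
    ∃ g : G.toSimpleGraph.edgeSet → β, ∀ e (x y : G.vertexSet),
      G.IsLink (g e) x y ↔ e.1 = s(x, y) := by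
  have : ∀ e : G.toSimpleGraph.edgeSet, ∃ b, ∀ x y : G.vertexSet,
      G.IsLink b x y ↔ e.1 = s(x, y) := by
    rintro ⟨e, he⟩
    induction e using Sym2.ind with | _ u v
    rw [SimpleGraph.mem_edgeSet, toSimpleGraph_adj_iff] at he
    obtain ⟨b, hb⟩ := he
    refine ⟨b, fun x y => ⟨fun h => ?_, fun h => ?_⟩⟩
    · change s(u, v) = s(x, y)
      obtain ⟨h1, h2⟩ | ⟨h1, h2⟩ := hb.eq_and_eq_or_eq_and_eq h
      · rw [Subtype.ext h1, Subtype.ext h2]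
      · rw [Subtype.ext h1, Subtype.ext h2]
        exact Sym2.eq_swap
    · obtain ⟨rfl, rfl⟩ | ⟨rfl, rfl⟩ := Sym2.eq_iff.1 h
      · exact hb
      · exact hb.symm
  choose g hg using this
  exact ⟨g, hg⟩

/-- The spanning subgraph of `G` whose edges are those chosen by `g` for the pairs in `D`. -/
noncomputable def realize (g : G.toSimpleGraph.edgeSet → β) (D : Set (Sym2 G.vertexSet)) :
    Graph α β :=
  G.restrict {b | ∃ e : G.toSimpleGraph.edgeSet, e.1 ∈ D ∧ g e = b}

section realize

variable {g : G.toSimpleGraph.edgeSet → β} {D D' : Set (Sym2 G.vertexSet)}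

lemma injective_of_edge_choice
    (hg : ∀ e (x y : G.vertexSet), G.IsLink (g e) x y ↔ e.1 = s(x, y)) :
    Function.Injective g := by
  rintro ⟨e, he⟩ ⟨f, hf⟩ h
  induction e using Sym2.ind with | _ u v
  have h1 := (hg ⟨_, he⟩ u v).2 rfl
  rw [h] at h1
  exact Subtype.ext ((hg ⟨f, hf⟩ u v).1 h1).symm

lemma realize_isSpanningSubgraph (h : D ⊆ D') : realize g D ≤s realize g D' where
  vertexSet_mono := Set.Subset.rfl
  isLink_mono := by
    rintro e x y ⟨⟨f, hf, rfl⟩, hl⟩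
    exact ⟨⟨f, h hf, rfl⟩, hl⟩
  vertexSet_eq := rfl

lemma realize_isSpanningSubgraph_self : realize g D ≤s G where
  vertexSet_mono := Set.Subset.rfl
  isLink_mono := fun _ _ _ h => h.2
  vertexSet_eq := rfl

lemma disjoint_edgeSet_realize
    (hg : ∀ e (x y : G.vertexSet), G.IsLink (g e) x y ↔ e.1 = s(x, y)) (h : Disjoint D D') :
    Disjoint (realize g D).edgeSet (realize g D').edgeSet := by
  rw [Set.disjoint_left] at h ⊢
  rintro b ⟨-, e, he, rfl⟩ ⟨-, f, hf, hfe⟩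
  obtain rfl := injective_of_edge_choice hg hfe
  exact h he hf

lemma isTree_realize [G.Loopless]
    (hg : ∀ e (x y : G.vertexSet), G.IsLink (g e) x y ↔ e.1 = s(x, y))
    {T : SimpleGraph G.vertexSet} (hT : T.IsTree) (hTG : T ≤ G.toSimpleGraph) :
    (realize g T.edgeSet).IsTree := by
  have hloop : (realize g T.edgeSet).Loopless :=
    ⟨fun e x h => Loopless.not_isLoopAt (G := G) e x h.2⟩
  refine ⟨⟨?_⟩, ?_⟩
  · rintro e f x y ⟨⟨e, -, rfl⟩, he⟩ ⟨⟨f, -, rfl⟩, hf⟩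
    have h1 := (hg e ⟨x, he.left_mem⟩ ⟨y, he.right_mem⟩).1 he
    have h2 := (hg f ⟨x, he.left_mem⟩ ⟨y, he.right_mem⟩).1 hf
    rw [Subtype.ext (h1.trans h2.symm)]
  · have h : (realize g T.edgeSet).toSimpleGraph = T := by
      ext u v
      rw [toSimpleGraph_adj_iff]
      constructor
      · rintro ⟨b, ⟨e, he, rfl⟩, hl⟩
        have h1 := (hg e u v).1 hl
        rw [h1] at he
        exact he
      · intro h
        exact ⟨g ⟨s(u, v), hTG h⟩, ⟨⟨s(u, v), hTG h⟩, h, rfl⟩, (hg _ u v).2 rfl⟩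
    rw [← h] at hT
    exact hT

open Classical in
lemma degree_realize [G.Loopless]
    (hg : ∀ e (x y : G.vertexSet), G.IsLink (g e) x y ↔ e.1 = s(x, y))
    {D : Finset (Sym2 G.vertexSet)} (hD : ∀ e ∈ D, e ∈ G.toSimpleGraph.edgeSet)
    (v : G.vertexSet) : (realize g (D : Set (Sym2 G.vertexSet))).degree v.1 =
      (D.filter (v ∈ ·)).card := by
  have h1 : (realize g (D : Set (Sym2 G.vertexSet))).loopSet v.1 = ∅ :=
    Set.eq_empty_of_forall_notMem fun e h => Loopless.not_isLoopAt (G := G) e v.1 h.2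
  rw [degree, h1, Set.ncard_empty, add_zero, ← Set.ncard_coe_finset]
  symm
  refine Set.ncard_congr (fun e he => g ⟨e, hD e (Finset.mem_filter.1 he).1⟩) ?_ ?_ ?_
  · intro e he
    obtain ⟨heD, u, rfl⟩ := Finset.mem_filter.1 (Finset.mem_coe.1 he)
    exact ⟨u.1, ⟨_, heD, rfl⟩, (hg _ v u).2 rfl⟩
  · intro e f he hf h
    exact congrArg Subtype.val (injective_of_edge_choice hg h)
  · rintro b ⟨y, ⟨e, he, rfl⟩, hl⟩
    have h2 := (hg e v ⟨y, hl.right_mem⟩).1 hl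
    exact ⟨e.1, Finset.mem_coe.2 (Finset.mem_filter.2 ⟨he, h2 ▸ Sym2.mem_mk_left _ _⟩), rfl⟩

end realize

open Classical in
theorem exists_treeConnected_factor [G.Loopless] (hne : G.vertexSet.Nonempty)
    (hV : G.vertexSet.Finite) {m r : ℕ} (hm : 1 ≤ m) (hiso : G.IsIsoTough ((r : ℝ) + 1))
    {ε : ℝ} (hε : 0 < ε) (hr : (2 * (m : ℝ) - 1) * (2 * (m : ℝ) / ε + 1) ≤ (r : ℝ))
    (h : ∀ S ⊆ G.vertexSet, ((G.deleteVerts S).numComponents : ℝ) ≤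
      1 / (2 * (m : ℝ) + ε) * (S.ncard : ℝ) + 1) :
    ∃ H : Graph α β, H.IsFactor G {r, r + 1} ∧ H.IsTreeConnected m := by
  have : Fintype G.vertexSet := hV.fintype
  have : Nonempty G.vertexSet := hne.to_subtype
  have hm1 : (1 : ℝ) ≤ m := by exact_mod_cast hm
  -- The second factor in `hr` exceeds 1, so r > 2m - 1.
  have hr2m : 2 * m ≤ r := by
    have h1 : 0 < 2 * (m : ℝ) / ε := by positivity
    have h2 : 2 * (m : ℝ) - 1 < r := by nlinarith
    have h3 : 2 * (m : ℝ) < r + 1 := by linarith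
    have : 2 * m < r + 1 := by exact_mod_cast h3
    omega
  have hrτ : (2 * (m : ℝ) - 1) * (2 * m + ε) ≤ r * (2 * m + ε - 2 * m) := by
    have h1 := mul_le_mul_of_nonneg_right hr hε.le
    have h2 : (2 * (m : ℝ) - 1) * (2 * (m : ℝ) / ε + 1) * ε = (2 * (m : ℝ) - 1) * (2 * m + ε) := by
      field_simp
    rw [h2] at h1
    linarith
  have hcomp := fewComponents_of_numComponents_le h
  obtain ⟨Q, hQ, F, hFG, hdeg⟩ := SimpleGraph.exists_nearly_regular_factor (r := r) (by omega)
    (by linarith) hcomp hiso.mul_card_le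
  have hdiag : ∀ e ∈ G.toSimpleGraph.edgeFinset, ¬ e.IsDiag := fun e he =>
    SimpleGraph.not_isDiag_of_mem_edgeSet _ (SimpleGraph.mem_edgeFinset.1 he)
  obtain ⟨N, hN, I, hI, hsp, hti⟩ := SparseEdges.exists_matching_sparse_tight
    (E := G.toSimpleGraph.edgeFinset \ F) (F := F) hm hr2m (by linarith) hrτ
    Finset.sdiff_disjoint (fun e he => hdiag e (Finset.sdiff_subset he))
    (fun e he => hdiag e (hFG he)) (fun v => by rw [hdeg]; omega)
    (by rwa [Finset.sdiff_union_of_subset hFG]) hQ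
  obtain ⟨T, hT, hTdisj⟩ := hsp.exists_spanning_trees hti
  obtain ⟨g, hg⟩ := exists_edge_choice (G := G)
  have hFN : ∀ e ∈ F ∪ N, e ∈ G.toSimpleGraph.edgeSet := fun e he => by
    rw [← SimpleGraph.mem_edgeFinset]
    exact (Finset.mem_union.1 he).elim (fun h => hFG h)
      fun h => Finset.sdiff_subset (hN.subset h)
  refine ⟨realize g ((F ∪ N : Finset _) : Set (Sym2 G.vertexSet)),
    ⟨realize_isSpanningSubgraph_self, fun v hv => ?_⟩,
    fun i => realize g (T i).edgeSet, fun i => ⟨?_, ?_⟩, fun i j hij => ?_⟩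
  · have h1 := degree_realize hg hFN ⟨v, hv⟩
    rw [h1, Finset.filter_union, Finset.card_union_of_disjoint, hdeg]
    · have h2 : (N.filter ((⟨v, hv⟩ : G.vertexSet) ∈ ·)).card ≤ 1 := by
        rw [Finset.card_le_one]
        intro e he f hf
        rw [Finset.mem_filter] at he hf
        exact hN.eq_of_mem e he.1 f hf.1 _ he.2 hf.2
      -- The matching avoids the vertex of degree r + 1 and raises every other degree by at most
      -- one.
      by_cases hvQ : (⟨v, hv⟩ : G.vertexSet) ∈ Q
      · have h3 : N.filter ((⟨v, hv⟩ : G.vertexSet) ∈ ·) = ∅ :=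
          Finset.filter_eq_empty_iff.2 fun e he => hN.avoid _ hvQ e he
        rw [h3, if_pos hvQ]
        exact Or.inr rfl
      · rw [if_neg hvQ]
        simp only [Set.mem_insert_iff, Set.mem_singleton_iff]
        omega
    · exact Finset.disjoint_filter_filter (Finset.disjoint_sdiff.mono_right hN.subset)
  · exact realize_isSpanningSubgraph fun e he => Finset.mem_coe.2 (hI ((hT i).2 e he))
  · refine isTree_realize hg (hT i).1 fun u v huv => ?_
    exact hFN s(u, v) (hI ((hT i).2 _ huv))
  · exact disjoint_edgeSet_realize hg (hTdisj i j hij)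

end Graph

end

theorem mainTheorem2 {α β : Type*} (G : Graph α β) [G.Loopless]
    (hne : G.vertexSet.Nonempty) (hV : G.vertexSet.Finite) (hE : G.edgeSet.Finite)
    (m r : ℕ) (hm : 1 ≤ m) (hiso : G.IsIsoTough ((r : ℝ) + 1)) :
    (∀ ε : ℝ, 0 < ε →
      (2 * (m : ℝ) - 1) * (2 * (m : ℝ) / ε + 1) ≤ (r : ℝ) →
      (∀ S ⊆ G.vertexSet,
        ((G.deleteVerts S).numComponents : ℝ) ≤
          1 / (2 * (m : ℝ) + ε) * (S.ncard : ℝ) + 1) →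
      ∃ H : Graph α β, H.IsFactor G {r, r + 1} ∧ H.IsTreeConnected m) ∧
    (G.IsTough (3 * (m : ℝ)) →
      6 * (m : ℝ) - 3 ≤ (r : ℝ) →
      ∃ H : Graph α β, H.IsFactor G {r, r + 1} ∧ H.IsTreeConnected m) := by
  have hm1 : (1 : ℝ) ≤ m := by exact_mod_cast hm
  have hm0 : (0 : ℝ) < m := by linarith
  -- The second statement is the case ε = m, where 2m + ε = 3m and the bound on r is 3(2m - 1) = 6m
  -- - 3; max{1, x} ≤ x + 1 converts toughness.
  refine ⟨fun ε hε hr h => Graph.exists_treeConnected_factor hne hV hm hiso hε hr h,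
    fun h hr => Graph.exists_treeConnected_factor hne hV hm hiso hm0 ?_ fun S hS => ?_⟩
  · rw [mul_div_cancel_right₀ _ hm0.ne']
    linarith
  · have h2 : 2 * (m : ℝ) + m = 3 * m := by ring
    rw [h2]
    refine (h S hS).trans (max_le ?_ ?_)
    · have : 0 ≤ 1 / (3 * (m : ℝ)) * (S.ncard : ℝ) := by positivity
      linarith
    · linarith
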